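/- Let $p>2$ be a prime, $L/\mathbb{Q}_p$ a finite extension with ring of integers $\mathcal{O}$, uniformizer $\varpi$ and residue field $k$. Let $\rho\colon G_{\mathbb{Q}_p}\to \mathrm{GL}_2(k)$ be a continuous representation of the form $\rho(g)=\begin{pmatrix}1&\phi(g)\\0&1\end{pmatrix}$, let $\epsilon$ be the $p$-adic cyclotomic character and $\psi\colon G_{\mathbb{Q}_p}\to\mathcal{O}^\times$ a continuous character with $\psi\epsilon\equiv 1 \bmod \varpi$. Let $\gamma,\delta\in G_{\mathbb{Q}_p}$ and let $a,b\in\mathcal{O}$ be lifts of $\phi(\gamma),\phi(\delta)\in k$ (for instance the Teichmüller lifts). Put $x_{12}:=\hat x_{12}+a$, $y_{12}:=\hat y_{12}+b$, $z:=x_{12}y_{21}+2x_{11}y_{11}+x_{21}y_{12}$ and $$R^{\square,\psi}_\rho:=\mathcal{O}[[x_{11},\hat x_{12},x_{21},t_\gamma,y_{11},\hat y_{12},y_{21},t_\delta]]/I,$$ $$I:=\big((1+t_\gamma)^2-x_{11}^2-x_{12}x_{21}-\psi\epsilon(\gamma),\ (1+t_\delta)^2-y_{11}^2-y_{12}y_{21}-\psi\epsilon(\delta)\big).$$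 (1) There is a unique homomorphism of $\mathcal{O}$-algebras $\Phi\colon\mathcal{O}[[t_1,t_2,t_3]]\to R^{\square,\psi}_\rho$ with $t_1\mapsto t_\gamma$, $t_2\mapsto t_\delta$, $t_3\mapsto (1+t_\gamma)(1+t_\delta)+\tfrac12 z-1$, and it makes $R^{\square,\psi}_\rho$ a flat $\mathcal{O}[[t_1,t_2,t_3]]$-module. (2) Suppose that $\gamma,\delta$ map to free generators of the maximal pro-$p$ quotient of $G_{\mathbb{Q}_p}$ (a free pro-$p$ group of rank $2$). Then $R^{\square,\psi}_\rho$ is the universal framed deformation ring of $\rho$ with determinant $\psi\epsilon$: it is a complete local noetherian $\mathcal{O}$-algebra with residue field $k$, and there is a continuous lift $\rho^\square\colon G_{\mathbb{Q}_p}\to\mathrm{GL}_2(R^{\square,\psi}_\rho)$ of $\rho$ with determinant $\psi\epsilon$ and $$\rho^\square(\gamma)=\begin{pmatrix}1+t_\gamma+x_{11}&x_{12}\\x_{21}&1+t_\gamma-x_{11}\end{pmatrix},\qquad \rho^\square(\delta)=\begin{pmatrix}1+t_\delta+y_{11}&y_{12}\\y_{21}&1+t_\delta-y_{11}\end{pmatrix},$$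 such that every continuous lift of $\rho$ with determinant $\psi\epsilon$ to a local artinian $\mathcal{O}$-algebra $A$ with residue field $k$ is induced from $\rho^\square$ by a unique $\mathcal{O}$-algebra homomorphism $R^{\square,\psi}_\rho\to A$. Moreover $\Phi$ is the trace map: $\operatorname{tr}\rho^\square(\gamma)=\Phi(2(1+t_1))$, $\operatorname{tr}\rho^\square(\delta)=\Phi(2(1+t_2))$ and $\operatorname{tr}\rho^\square(\gamma\delta)=\operatorname{tr}\rho^\square(\delta\gamma)=\Phi(2(1+t_3))$. -/

import Mathlib

open IsLocalRing

universe u v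

/-! ### The ring of integers of a finite extension of `ℚ_p` -/

section RingOfIntegers

variable (p : ℕ) [Fact p.Prime] (L : Type u) [Field L] [Algebra ℚ_[p] L]
  [FiniteDimensional ℚ_[p] L] [Algebra ℤ_[p] L] [IsScalarTower ℤ_[p] ℚ_[p] L]

/-- The ring of integers `𝒪` of a finite extension `L` of `ℚ_p`. -/
noncomputable abbrev PadicRingOfIntegers : Subalgebra ℤ_[p] L := integralClosure ℤ_[p] L

theorem mem_padicRingOfIntegers_iff (x : L) :
    x ∈ PadicRingOfIntegers p L ↔ spectralNorm ℚ_[p] L x ≤ 1 := by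
  have hint : IsIntegral ℚ_[p] x := Algebra.IsIntegral.isIntegral x
  rw [mem_integralClosure_iff, spectralNorm, spectralValue_le_one_iff (minpoly.monic hint)]
  constructor
  · intro hx n
    rw [minpoly.isIntegrallyClosed_eq_field_fractions' ℚ_[p] hx, Polynomial.coeff_map]
    exact PadicInt.norm_le_one _
  · intro h
    have hl : minpoly ℚ_[p] x ∈ Polynomial.lifts (algebraMap ℤ_[p] ℚ_[p]) := by
      rw [Polynomial.lifts_iff_coeff_lifts]
      intro n
      exact ⟨⟨_, h n⟩, rfl⟩
    obtain ⟨q, hq, -, hqm⟩ :=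
      Polynomial.lifts_and_natDegree_eq_and_monic hl (minpoly.monic hint)
    refine ⟨q, hqm, ?_⟩
    have := minpoly.aeval ℚ_[p] x
    rw [← hq, Polynomial.aeval_map_algebraMap] at this
    simpa [Polynomial.aeval_def] using this

theorem norm_one_of_isUnit_padicRingOfIntegers (x : PadicRingOfIntegers p L) :
    IsUnit x ↔ spectralNorm ℚ_[p] L (x : L) = 1 := by
  have hmul : ∀ y z : L, spectralNorm ℚ_[p] L (y * z) =
      spectralNorm ℚ_[p] L y * spectralNorm ℚ_[p] L z := fun y z =>
    spectralAlgNorm_mul (K := ℚ_[p]) (L := L) y z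
  have hone : spectralNorm ℚ_[p] L (1 : L) = 1 := spectralNorm_one
  have hx := (mem_padicRingOfIntegers_iff p L x).1 x.2
  constructor
  · intro hu
    obtain ⟨y, hy⟩ := isUnit_iff_exists_inv.1 hu
    have hy1 := (mem_padicRingOfIntegers_iff p L y).1 y.2
    have e : (x : L) * (y : L) = 1 := by
      rw [← MulMemClass.coe_mul, hy, OneMemClass.coe_one]
    have h1 := hmul (x : L) (y : L)
    rw [e, hone] at h1
    have h0 := spectralNorm_nonneg (K := ℚ_[p]) (L := L) (x : L)
    nlinarith
  · intro h
    have hx0 : (x : L) ≠ 0 := by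
      intro h0
      rw [h0, spectralNorm_zero] at h
      exact zero_ne_one h
    have h2 : spectralNorm ℚ_[p] L ((x : L)⁻¹) = 1 := by
      have := hmul (x : L) (x : L)⁻¹
      rw [mul_inv_cancel₀ hx0, hone, h, one_mul] at this
      exact this.symm
    exact IsUnit.of_mul_eq_one ⟨(x : L)⁻¹, (mem_padicRingOfIntegers_iff p L _).2 h2.le⟩
      (Subtype.ext (mul_inv_cancel₀ hx0))

instance padicRingOfIntegers_isLocalRing : IsLocalRing (PadicRingOfIntegers p L) := by
  refine IsLocalRing.of_nonunits_add fun x y hx hy => ?_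
  simp only [mem_nonunits_iff, norm_one_of_isUnit_padicRingOfIntegers] at hx hy ⊢
  have hx1 := lt_of_le_of_ne ((mem_padicRingOfIntegers_iff p L x).1 x.2) hx
  have hy1 := lt_of_le_of_ne ((mem_padicRingOfIntegers_iff p L y).1 y.2) hy
  have := isNonarchimedean_spectralNorm (K := ℚ_[p]) (L := L) (x : L) (y : L)
  exact (this.trans_lt (max_lt hx1 hy1)).ne

end RingOfIntegers

/-! ### Framed deformations with fixed determinant -/

section Deformations

/-- Continuity of a representation `G → GL₂(A)`, where `A` is a local ring with its
`𝔪_A`-adic topology: for all `n`, the `g` with `ρ(g) ≡ 1` modulo `𝔪_A ^ n` form an open set. -/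
def IsAdicContinuousRep {G : Type v} [Group G] [TopologicalSpace G] {A : Type u} [CommRing A]
    [IsLocalRing A] (ρ : G →* GL (Fin 2) A) : Prop :=
  ∀ n : ℕ, IsOpen {g : G | ∀ i j, ρ g i j - (1 : Matrix (Fin 2) (Fin 2) A) i j ∈
    maximalIdeal A ^ n}

/-- Continuity of a character `G → A^×`, where `A` is a local ring with its
`𝔪_A`-adic topology. -/
def IsAdicContinuousChar {G : Type v} [Group G] [TopologicalSpace G] {A : Type u} [CommRing A]
    [IsLocalRing A] (χ : G →* Aˣ) : Prop :=
  ∀ n : ℕ, IsOpen {g : G | (χ g : A) - 1 ∈ maximalIdeal A ^ n}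

/-- `A` is a local `𝒪`-algebra with the same residue field: the structure map is local and
induces an isomorphism of residue fields. -/
structure IsLocalAlgebraWithSameResidueField (O : Type u) [CommRing O] [IsLocalRing O]
    (A : Type u) [CommRing A] [IsLocalRing A] [Algebra O A] : Prop where
  isLocalHom : IsLocalHom (algebraMap O A)
  bijective : Function.Bijective (ResidueField.map (algebraMap O A))

/-- `ρA : G → GL₂(A)` is a framed deformation (a lift) to `A` of
`ρ : G → GL₂(k)`, `k` the residue field of `𝒪`, with determinant the character `d` :
it is continuous, reduces to `ρ` modulo `𝔪_A`, and `det ρA = d`. -/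
structure IsFramedDeformation {G : Type v} [Group G] [TopologicalSpace G] {O : Type u}
    [CommRing O] [IsLocalRing O] (ρ : G →* GL (Fin 2) (ResidueField O)) (d : G →* Oˣ)
    {A : Type u} [CommRing A] [IsLocalRing A] [Algebra O A] (ρA : G →* GL (Fin 2) A) :
    Prop where
  continuous : IsAdicContinuousRep ρA
  reduction : ∀ (g : G) (i j : Fin 2) (c : O), residue O c = ρ g i j →
    residue A (ρA g i j) = residue A (algebraMap O A c)
  det_eq : ∀ g : G, ((ρA g : Matrix (Fin 2) (Fin 2) A)).det = algebraMap O A (d g : O)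

/-- `(R, ρR)` is the universal framed deformation of `ρ` with determinant `d`: `R` is a complete
local noetherian `𝒪`-algebra with residue field `k`, `ρR` is a framed deformation of `ρ` to `R`
with determinant `d`, and every such deformation to a local artinian `𝒪`-algebra `A` with residue
field `k` is the image of `ρR` under a unique homomorphism of `𝒪`-algebras `R → A`.
(Such a homomorphism is automatically local and continuous.) -/
structure IsUniversalFramedDeformation {G : Type v} [Group G] [TopologicalSpace G] {O : Type u}
    [CommRing O] [IsLocalRing O] (ρ : G →* GL (Fin 2) (ResidueField O)) (d : G →* Oˣ)
    {R : Type u} [CommRing R] [IsLocalRing R] [Algebra O R] (ρR : G →* GL (Fin 2) R) :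
    Prop where
  isNoetherianRing : IsNoetherianRing R
  isAdicComplete : IsAdicComplete (maximalIdeal R) R
  residueField : IsLocalAlgebraWithSameResidueField O R
  isFramedDeformation : IsFramedDeformation ρ d ρR
  universal : ∀ (A : Type u) [CommRing A] [IsLocalRing A] [IsArtinianRing A] [Algebra O A],
    IsLocalAlgebraWithSameResidueField O A → ∀ ρA : G →* GL (Fin 2) A,
      IsFramedDeformation ρ d ρA →
        ∃! f : R →ₐ[O] A, ∀ g, Matrix.GeneralLinearGroup.map (f : R →+* A) (ρR g) = ρA g

/-- The images of `γ` and `δ` in the maximal pro-`p` quotient `G(p)` of the profinite group `G`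
form a basis of `G(p)` as a free pro-`p` group: continuous homomorphisms from `G(p)`, equivalently
from `G`, to a finite `p`-group are given by prescribing arbitrarily the images of `γ`, `δ`. -/
def IsFreeProPBasis (p : ℕ) {G : Type v} [Group G] [TopologicalSpace G] (γ δ : G) : Prop :=
  ∀ (H : Type) [Group H] [Finite H] [TopologicalSpace H] [DiscreteTopology H],
    IsPGroup p H → ∀ a b : H, ∃! f : G →* H, Continuous f ∧ f γ = a ∧ f δ = b

end Deformations

/-! ### The explicit ring

The variables `x₁₁, x̂₁₂, x₂₁, t_γ, y₁₁, ŷ₁₂, y₂₁, t_δ` are `X 0, …, X 7` in this order. -/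

section ExplicitRing

variable {O : Type u} [CommRing O]

namespace FramedRing

/-- The power series ring `𝒪⟦x₁₁, x̂₁₂, x₂₁, t_γ, y₁₁, ŷ₁₂, y₂₁, t_δ⟧`. -/
abbrev PS (O : Type u) [CommRing O] : Type u := MvPowerSeries (Fin 8) O

noncomputable def x₁₁ : PS O := MvPowerSeries.X 0
/-- `x₁₂ = x̂₁₂ + a`, with `a` a lift of `φ(γ)`. -/
noncomputable def x₁₂ (a : O) : PS O := MvPowerSeries.X 1 + MvPowerSeries.C a
noncomputable def x₂₁ : PS O := MvPowerSeries.X 2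
noncomputable def tγ : PS O := MvPowerSeries.X 3
noncomputable def y₁₁ : PS O := MvPowerSeries.X 4
/-- `y₁₂ = ŷ₁₂ + b`, with `b` a lift of `φ(δ)`. -/
noncomputable def y₁₂ (b : O) : PS O := MvPowerSeries.X 5 + MvPowerSeries.C b
noncomputable def y₂₁ : PS O := MvPowerSeries.X 6
noncomputable def tδ : PS O := MvPowerSeries.X 7

/-- `z = x₁₂ y₂₁ + 2 x₁₁ y₁₁ + x₂₁ y₁₂`. -/
noncomputable def z (a b : O) : PS O := x₁₂ a * y₂₁ + 2 * x₁₁ * y₁₁ + x₂₁ * y₁₂ b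

/-- The matrix which is the value at `γ` of the universal framed deformation. -/
noncomputable def matγ (a : O) : Matrix (Fin 2) (Fin 2) (PS O) :=
  !![1 + tγ + x₁₁, x₁₂ a; x₂₁, 1 + tγ - x₁₁]

/-- The matrix which is the value at `δ` of the universal framed deformation. -/
noncomputable def matδ (b : O) : Matrix (Fin 2) (Fin 2) (PS O) :=
  !![1 + tδ + y₁₁, y₁₂ b; y₂₁, 1 + tδ - y₁₁]

/-- The ideal of the conditions that the determinants at `γ` and `δ` are `c` and `d`. -/
noncomputable def detIdeal (a b c d : O) : Ideal (PS O) :=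
  Ideal.span {(1 + tγ) ^ 2 - x₁₁ ^ 2 - x₁₂ a * x₂₁ - MvPowerSeries.C c,
    (1 + tδ) ^ 2 - y₁₁ ^ 2 - y₁₂ b * y₂₁ - MvPowerSeries.C d}

end FramedRing

/-- The ring `𝒪⟦x₁₁, x̂₁₂, x₂₁, t_γ, y₁₁, ŷ₁₂, y₂₁, t_δ⟧ / I`. -/
abbrev FramedDetRing (a b c d : O) : Type u := FramedRing.PS O ⧸ FramedRing.detIdeal a b c d

/-- The quotient map onto `FramedDetRing a b c d`. -/
noncomputable abbrev FramedDetRing.mk (a b c d : O) : FramedRing.PS O →+* FramedDetRing a b c d :=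
  Ideal.Quotient.mk (FramedRing.detIdeal a b c d)

/-- The explicit formulas for the trace map `Φ` on the variables `t₁, t₂, t₃`. -/
def IsTraceMap (a b c d : O) (Φ : MvPowerSeries (Fin 3) O →ₐ[O] FramedDetRing a b c d) : Prop :=
  Φ (MvPowerSeries.X 0) = FramedDetRing.mk a b c d FramedRing.tγ ∧
  Φ (MvPowerSeries.X 1) = FramedDetRing.mk a b c d FramedRing.tδ ∧
  Φ (MvPowerSeries.X 2) = FramedDetRing.mk a b c d
    ((1 + FramedRing.tγ) * (1 + FramedRing.tδ) + Ring.inverse 2 * FramedRing.z a b - 1)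

end ExplicitRing

/-! ### The absolute Galois group of `ℚ_p` and the cyclotomic character -/

/-- The absolute Galois group `G_{ℚ_p}`, with the Krull topology. -/
abbrev GalQp (p : ℕ) [Fact p.Prime] : Type := Field.absoluteGaloisGroup ℚ_[p]

/-- The `p`-adic cyclotomic character of `G_{ℚ_p}`, with values in `𝒪^×`. -/
noncomputable def cycloChar (p : ℕ) [Fact p.Prime] (O : Type u) [CommRing O] [Algebra ℤ_[p] O] :
    GalQp p →* Oˣ :=
  (Units.map (algebraMap ℤ_[p] O : ℤ_[p] →* O)).comp
    ((cyclotomicCharacter (AlgebraicClosure ℚ_[p]) p).comp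
      (MulSemiringAction.toRingAut (AlgebraicClosure ℚ_[p] ≃ₐ[ℚ_[p]] AlgebraicClosure ℚ_[p])
        (AlgebraicClosure ℚ_[p])))

/-!
Put `R = FramedDetRing a b (ψε γ) (ψε δ)`.

**Universality.** A framed deformation of `ρ` is upper unipotent modulo the maximal ideal. Over the
quotient of a local noetherian ring by a power of its maximal ideal, if the residue field is finite
of characteristic `p`, such matrices form a finite `p`-group (`isPGroup_residuallyUnipotent`): they
are an extension of a subgroup of the additive group of the residue field by a congruence
subgroup. A continuous representation with values in such a group is therefore given by an arbitrary
choice of its values at `γ` and `δ`, and the same holds in the limit over complete local rings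
(`IsFreeProPBasis.exists_rep`, `IsFreeProPBasis.rep_ext`). The ring `R` is the quotient of a power
series ring whose eight variables are the coordinates of two matrices and whose two relations
prescribe the determinants, so it carries the universal pair of such matrices and thus a
representation `ρu`. That `ρu` has the right reduction and the right determinant needs to be known
at `γ` and `δ` only (`IsFreeProPBasis.isFramedDeformation`), by uniqueness of representations and of
characters. Since `2` is invertible, the coordinates of a pair of matrices are determined by the
matrices (`FramedDetRing.map_matγ_matδ_iff`), which gives the universal property
(`IsFreeProPBasis.existsUnique_algHom`). Homomorphisms of `𝒪`-algebras out of power series rings are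
controlled by their values on the variables, without assuming continuity
(`MvPowerSeries.exists_algHom_apply_X`, `MvPowerSeries.algHom_ext_of_isHausdorff`).

**Flatness.** Eliminating `t_γ` and `t_δ`, the ring `R` is a quotient of
`𝒪⟦t₁, t₂, t₃⟧⟦x₁₁, x̂₁₂, x₂₁, y₁₁, ŷ₁₂, y₂₁⟧` by three relations. By the local criterion, in the form
of `FlatModulo.sup_span_singleton`, it is flat over `𝒪⟦t₁, t₂, t₃⟧` as soon as the relations restrict
to a regular sequence on the closed fibre, where up to units they are the quadrics
`x₁₁² + x₁₂ x₂₁`, `y₁₁² + y₁₂ y₂₁` and `x₁₂ y₂₁ + 2 x₁₁ y₁₁ + x₂₁ y₁₂`. This is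
`FramedRing.isWeaklyRegular_quadrics`: together with three suitable linear forms the quadrics
generate an ideal primary to the maximal ideal, and regular sequences in a local ring can be
permuted.

Both parts hold over any complete local noetherian ring `𝒪` in which `2` is invertible, with finite
residue field of characteristic `p` for the first; the last part of the file checks these properties
for the ring of integers of a finite extension of `ℚ_p`, and the continuity of the cyclotomic
character.
-/

/-! ### Power series and completeness -/

namespace MvPowerSeries

section Evaluation

variable {σ A R : Type*} [CommRing A] [CommRing R]

theorem coeff_eq_zero_of_mem_pow_span_X {n : ℕ} {f : MvPowerSeries σ A}
    (hf : f ∈ Ideal.span (Set.range (X : σ → MvPowerSeries σ A)) ^ n) {d : σ →₀ ℕ}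
    (hd : d.degree < n) : coeff d f = 0 := by
  have key : ∀ n : ℕ, ∀ f ∈ Ideal.span (Set.range (X : σ → MvPowerSeries σ A)) ^ n,
      (n : ℕ∞) ≤ f.order := by
    intro n
    induction n with
    | zero => simp
    | succ n ih =>
      intro f hf
      rw [pow_succ] at hf
      refine Submodule.mul_induction_on hf ?_ ?_
      · intro a ha b hb
        have h1 : (1 : ℕ∞) ≤ b.order := by
          rw [one_le_order_iff_constCoeff_eq_zero]
          have : Ideal.span (Set.range (X : σ → MvPowerSeries σ A)) ≤
              RingHom.ker (constantCoeff (σ := σ) (R := A)) := by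
            rw [Ideal.span_le]
            rintro _ ⟨i, rfl⟩
            simp
          exact this hb
        push_cast
        exact (add_le_add (ih a ha) h1).trans le_order_mul
      · intro a b ha hb
        exact (le_min ha hb).trans min_order_le_add
  exact coeff_of_lt_order (lt_of_lt_of_le (by exact_mod_cast hd) (key n f hf))

variable [Finite σ]

/-- A power series differs from its truncation by an element of a power of the ideal generated by
the variables. The truncations form a Cauchy sequence for this ideal, as one sees on polynomials,
and the power series is its limit. -/
theorem sub_truncTotal_mem_pow_span_X (f : MvPowerSeries σ A) (n : ℕ) :
    f - (truncTotal n f : MvPowerSeries σ A) ∈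
      Ideal.span (Set.range (X : σ → MvPowerSeries σ A)) ^ n := by
  set J := Ideal.span (Set.range (X : σ → MvPowerSeries σ A)) with hJ
  have hmap : (MvPolynomial.idealOfVars σ A).map
      (MvPolynomial.coeToMvPowerSeries.ringHom (σ := σ) (R := A)) = J := by
    rw [MvPolynomial.idealOfVars, Ideal.map_span, ← Set.range_comp]
    congr 2
    ext1 i
    simp
  have hc : ∀ {l m k : ℕ}, l ≤ m → l ≤ k →
      ((truncTotal m f : MvPowerSeries σ A) - (truncTotal k f : MvPowerSeries σ A)) ∈ J ^ l := by
    intro l m k h1 h2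
    have := Ideal.mem_map_of_mem (MvPolynomial.coeToMvPowerSeries.ringHom (σ := σ) (R := A))
      (truncTotal_sub_truncTotal_mem_pow_idealOfVars h1 h2 f)
    rw [Ideal.map_pow, hmap, map_sub] at this
    exact this
  obtain ⟨g, hg⟩ := IsPrecomplete.prec (I := J) (M := MvPowerSeries σ A) inferInstance
    (f := fun m => (truncTotal m f : MvPowerSeries σ A)) (by
      intro m k hmk
      rw [SModEq.sub_mem, smul_eq_mul, Ideal.mul_top]
      exact hc le_rfl hmk)
  have hfg : f = g := by
    ext d
    have h := hg (d.degree + 1)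
    rw [SModEq.sub_mem, smul_eq_mul, Ideal.mul_top] at h
    have := coeff_eq_zero_of_mem_pow_span_X h (d := d) (by omega)
    rw [map_sub, sub_eq_zero, MvPolynomial.coeff_coe, coeff_truncTotal _ (by omega)] at this
    exact this
  have h := hg n
  rw [SModEq.sub_mem, smul_eq_mul, Ideal.mul_top] at h
  rw [← neg_mem_iff, neg_sub]
  rwa [← hfg] at h

/-- Evaluation of power series at elements of an ideal for which the target is complete. -/
theorem exists_algHom_apply_X [Algebra A R] (I : Ideal R) [IsAdicComplete I R] (r : σ → R)
    (hr : ∀ i, r i ∈ I) : ∃ f : MvPowerSeries σ A →ₐ[A] R, ∀ i, f (X i) = r i := by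
  have hle : MvPolynomial.idealOfVars σ A ≤ I.comap (MvPolynomial.aeval r) := by
    rw [MvPolynomial.idealOfVars, Ideal.span_le]
    rintro _ ⟨i, rfl⟩
    simpa using hr i
  have hle' (n : ℕ) : MvPolynomial.idealOfVars σ A ^ n ≤
      (I ^ n).comap (MvPolynomial.aeval r : MvPolynomial σ A →ₐ[A] R) :=
    (Ideal.pow_right_mono hle n).trans (Ideal.le_comap_pow _ n)
  let F (n : ℕ) : MvPowerSeries σ A →ₐ[A] R ⧸ I ^ n :=
    (Ideal.quotientMapₐ (I ^ n) (MvPolynomial.aeval r) (hle' n)).comp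
      ((truncTotalAlgHom σ A n).restrictScalars A)
  have hF (n : ℕ) (p) : F n p =
      Ideal.Quotient.mk (I ^ n) (MvPolynomial.aeval r (truncTotal n p)) := rfl
  have hcompat {m n : ℕ} (hmn : m ≤ n) :
      (Ideal.Quotient.factorₐ A (Ideal.pow_le_pow_right hmn)).comp (F n) = F m := by
    ext p
    rw [AlgHom.comp_apply, hF, hF]
    change Ideal.Quotient.mk _ _ = Ideal.Quotient.mk _ _
    rw [Ideal.Quotient.eq, ← map_sub]
    exact hle' m (truncTotal_sub_truncTotal_mem_pow_idealOfVars hmn le_rfl p)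
  refine ⟨IsAdicComplete.liftAlgHom I F hcompat, fun i => ?_⟩
  rw [IsHausdorff.eq_iff_smodEq (I := I)]
  intro n
  rw [SModEq.sub_mem, smul_eq_mul, Ideal.mul_top, ← Ideal.Quotient.eq,
    IsAdicComplete.mk_liftAlgHom, hF, Ideal.Quotient.eq]
  have : r i = MvPolynomial.aeval (R := A) r (MvPolynomial.X i) := by simp
  rw [this, ← map_sub]
  apply hle' n
  rw [MvPolynomial.mem_pow_idealOfVars_iff']
  intro x hx
  rw [MvPolynomial.coeff_sub, coeff_truncTotal _ hx, ← MvPolynomial.coe_X, MvPolynomial.coeff_coe,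
    sub_self]

/-- Algebra homomorphisms from power series to a separated ring are determined by the images of the
variables, if these are topologically nilpotent; no continuity is assumed. -/
theorem algHom_ext_of_isHausdorff [Algebra A R] (I : Ideal R) [IsHausdorff I R]
    {f g : MvPowerSeries σ A →ₐ[A] R} (hI : ∀ i, f (X i) ∈ I) (h : ∀ i, f (X i) = g (X i)) :
    f = g := by
  have hpoly : (f.comp (MvPolynomial.coeToMvPowerSeries.algHom A)) =
      (g.comp (MvPolynomial.coeToMvPowerSeries.algHom A)) := by
    ext i
    simpa using h i
  have hle (e : MvPowerSeries σ A →ₐ[A] R) (he : ∀ i, e (X i) ∈ I) (n : ℕ)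
      (p : MvPowerSeries σ A) : e p - e (truncTotal n p : MvPowerSeries σ A) ∈ I ^ n := by
    have h1 : Ideal.span (Set.range (X : σ → MvPowerSeries σ A)) ≤ I.comap e := by
      rw [Ideal.span_le]
      rintro _ ⟨i, rfl⟩
      exact he i
    rw [← map_sub]
    exact ((Ideal.pow_right_mono h1 n).trans (Ideal.le_comap_pow _ n))
      (sub_truncTotal_mem_pow_span_X p n)
  ext p
  rw [IsHausdorff.eq_iff_smodEq (I := I)]
  intro n
  rw [SModEq.sub_mem, smul_eq_mul, Ideal.mul_top]
  have e : f (truncTotal n p : MvPowerSeries σ A) = g (truncTotal n p : MvPowerSeries σ A) := by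
    simpa using DFunLike.congr_fun hpoly (truncTotal n p)
  have h1 := hle f hI n p
  have h2 := hle g (fun i => h i ▸ hI i) n p
  rw [e] at h1
  simpa using sub_mem h1 h2

end Evaluation

section Local

variable {σ A : Type*} [CommRing A] [IsLocalRing A]

theorem mem_maximalIdeal_iff {f : MvPowerSeries σ A} :
    f ∈ maximalIdeal (MvPowerSeries σ A) ↔ constantCoeff f ∈ maximalIdeal A := by
  rw [mem_maximalIdeal, mem_maximalIdeal, mem_nonunits_iff, mem_nonunits_iff,
    isUnit_iff_constantCoeff]

theorem X_mem_maximalIdeal (i : σ) : (X i : MvPowerSeries σ A) ∈ maximalIdeal _ := by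
  rw [mem_maximalIdeal_iff]
  simp

theorem C_mem_maximalIdeal_iff {a : A} :
    (C a : MvPowerSeries σ A) ∈ maximalIdeal _ ↔ a ∈ maximalIdeal A := by
  rw [mem_maximalIdeal_iff]
  simp

/-- With `mem_pow_maximalIdeal_of_coeff_mem_pow`, this describes the powers of the maximal ideal by
coefficients. -/
theorem coeff_mem_pow_of_mem_pow_maximalIdeal (n : ℕ) {f : MvPowerSeries σ A}
    (hf : f ∈ maximalIdeal (MvPowerSeries σ A) ^ n) (d : σ →₀ ℕ) :
    coeff d f ∈ maximalIdeal A ^ (n - d.degree) := by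
  classical
  induction n generalizing f d with
  | zero => simp
  | succ n ih =>
    rw [pow_succ] at hf
    refine Submodule.mul_induction_on hf ?_ ?_
    · intro a ha b hb
      rw [coeff_mul]
      refine Ideal.sum_mem _ fun x hx => ?_
      rw [Finset.HasAntidiagonal.mem_antidiagonal] at hx
      have hdeg : x.1.degree + x.2.degree = d.degree := by rw [← hx, map_add]
      by_cases h0 : x.2 = 0
      · have hb0 : coeff x.2 b ∈ maximalIdeal A := by
          rw [h0]
          exact mem_maximalIdeal_iff.1 hb
        have := Ideal.mul_mem_mul (ih ha x.1) hb0
        rw [← pow_succ] at this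
        exact Ideal.pow_le_pow_right (by omega) this
      · have : 0 < x.2.degree := by
          rw [Nat.pos_iff_ne_zero, Ne, Finsupp.degree_eq_zero_iff]
          exact h0
        exact Ideal.mul_mem_right _ _ (Ideal.pow_le_pow_right (by omega) (ih ha x.1))
    · intro a b ha hb
      rw [map_add]
      exact add_mem ha hb

variable [Finite σ]

theorem mem_pow_maximalIdeal_of_coeff_mem_pow (n : ℕ) {f : MvPowerSeries σ A}
    (hf : ∀ d, coeff d f ∈ maximalIdeal A ^ (n - d.degree)) :
    f ∈ maximalIdeal (MvPowerSeries σ A) ^ n := by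
  have hspan : Ideal.span (Set.range (X : σ → MvPowerSeries σ A)) ≤ maximalIdeal _ := by
    rw [Ideal.span_le]
    rintro _ ⟨i, rfl⟩
    exact X_mem_maximalIdeal i
  have h1 := Ideal.pow_right_mono hspan n (sub_truncTotal_mem_pow_span_X f n)
  rw [← sub_add_cancel f (truncTotal n f : MvPowerSeries σ A)]
  refine add_mem h1 ?_
  rw [MvPolynomial.as_sum (truncTotal n f)]
  rw [← MvPolynomial.coeToMvPowerSeries.ringHom_apply, map_sum]
  refine Ideal.sum_mem _ fun d hd => ?_
  rw [MvPolynomial.coeToMvPowerSeries.ringHom_apply, MvPolynomial.coe_monomial]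
  by_cases hdn : d.degree < n
  · rw [coeff_truncTotal _ hdn]
    have e : (monomial d (coeff d f) : MvPowerSeries σ A) = C (coeff d f) * monomial d 1 := by
      rw [← monomial_zero_eq_C_apply, monomial_mul_monomial, zero_add, mul_one]
    have hm : (monomial d 1 : MvPowerSeries σ A) ∈ maximalIdeal (MvPowerSeries σ A) ^ d.degree := by
      rw [monomial_one_eq, Finsupp.prod, Finsupp.degree_apply, ← Finset.prod_pow_eq_pow_sum]
      exact Ideal.prod_mem_prod fun i _ => Ideal.pow_mem_pow (X_mem_maximalIdeal i) _
    have hC : (C (coeff d f) : MvPowerSeries σ A) ∈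
        maximalIdeal (MvPowerSeries σ A) ^ (n - d.degree) := by
      have hle : maximalIdeal A ≤ (maximalIdeal (MvPowerSeries σ A)).comap C :=
        fun a ha => C_mem_maximalIdeal_iff.2 ha
      exact ((Ideal.pow_right_mono hle _).trans (Ideal.le_comap_pow _ _)) (hf d)
    have := Ideal.mul_mem_mul hC hm
    rw [← pow_add, Nat.sub_add_cancel hdn.le, ← e] at this
    exact this
  · rw [coeff_truncTotal_eq_zero _ (by omega)]
    simp

/-- Power series in finitely many variables over a complete local noetherian ring are complete. -/
instance isAdicComplete_maximalIdeal [IsNoetherianRing A] [IsAdicComplete (maximalIdeal A) A] :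
    IsAdicComplete (maximalIdeal (MvPowerSeries σ A)) (MvPowerSeries σ A) where
  prec' f hf := by
    have hf' : ∀ {m n : ℕ}, m ≤ n → ∀ d, coeff d (f m) - coeff d (f n) ∈
        maximalIdeal A ^ (m - d.degree) := by
      intro m n hmn d
      have h := hf hmn
      rw [SModEq.sub_mem, smul_eq_mul, Ideal.mul_top] at h
      rw [← map_sub]
      exact coeff_mem_pow_of_mem_pow_maximalIdeal m h d
    have hlim : ∀ d : σ →₀ ℕ, ∃ a : A, ∀ n,
        coeff d (f (n + d.degree)) - a ∈ maximalIdeal A ^ n := by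
      intro d
      obtain ⟨a, ha⟩ := IsPrecomplete.prec (I := maximalIdeal A) (M := A) inferInstance
        (f := fun n => coeff d (f (n + d.degree))) (by
          intro m n hmn
          rw [SModEq.sub_mem, smul_eq_mul, Ideal.mul_top]
          have := hf' (Nat.add_le_add_right hmn d.degree) d
          rwa [Nat.add_sub_cancel] at this)
      refine ⟨a, fun n => ?_⟩
      have := ha n
      rwa [SModEq.sub_mem, smul_eq_mul, Ideal.mul_top] at this
    choose a ha using hlim
    let g : MvPowerSeries σ A := fun d => a d
    have hg : ∀ d, coeff d g = a d := fun d => rfl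
    refine ⟨g, fun n => ?_⟩
    rw [SModEq.sub_mem, smul_eq_mul, Ideal.mul_top]
    refine mem_pow_maximalIdeal_of_coeff_mem_pow n fun d => ?_
    have h1 := hf' (show n ≤ n - d.degree + d.degree by omega) d
    have h2 := ha d (n - d.degree)
    have := add_mem h1 h2
    rw [map_sub, hg]
    rwa [sub_add_sub_cancel] at this

end Local

end MvPowerSeries

theorem IsPrecomplete.of_surjective_linearMap {A M N : Type*} [CommRing A] [AddCommGroup M]
    [Module A M] [AddCommGroup N] [Module A N] (I : Ideal A) [IsPrecomplete I M] (f : M →ₗ[A] N)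
    (hf : Function.Surjective f) : IsPrecomplete I N := by
  rw [← AdicCompletion.of_surjective_iff]
  have h1 := AdicCompletion.map_surjective I hf
  have h2 := AdicCompletion.of_surjective I M
  have e : AdicCompletion.map I f ∘ AdicCompletion.of I M = AdicCompletion.of I N ∘ f := by
    ext x
    simp
  exact Function.Surjective.of_comp (e ▸ h1.comp h2)

/-- A quotient of a complete local noetherian ring is complete. -/
theorem IsAdicComplete.quotient_of_isLocalRing {A : Type*} [CommRing A] [IsLocalRing A]
    [IsNoetherianRing A] [IsAdicComplete (maximalIdeal A) A] (J : Ideal A) [IsLocalRing (A ⧸ J)] :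
    IsAdicComplete (maximalIdeal (A ⧸ J)) (A ⧸ J) := by
  have : IsPrecomplete (maximalIdeal A) (A ⧸ J) :=
    IsPrecomplete.of_surjective_linearMap _ (Ideal.Quotient.mkₐ A J).toLinearMap
      (Ideal.Quotient.mkₐ_surjective A J)
  have h :=
    (IsPrecomplete.map_algebraMap_iff (I := maximalIdeal A) (S := A ⧸ J) (M := A ⧸ J)).2 this
  have e : (maximalIdeal A).map (algebraMap A (A ⧸ J)) = maximalIdeal (A ⧸ J) := by
    rw [IsLocalRing.map_maximalIdeal_of_surjective]
    exact Ideal.Quotient.mk_surjective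
  rw [e] at h
  exact { toIsPrecomplete := h, toIsHausdorff := inferInstance }

/-! ### Flatness of quotients by sequences that are regular on the closed fibre -/

namespace Module.Flat

/-- Flatness can be tested on colon ideals. -/
theorem of_forall_colon {S M : Type*} [CommRing S] [AddCommGroup M] [Module S M]
    (h : ∀ (I : Ideal S) (s : S) (m : M), s • m ∈ I • (⊤ : Submodule S M) →
      m ∈ (I.colon {s} : Ideal S) • (⊤ : Submodule S M)) : Module.Flat S M := by
  refine Module.Flat.of_forall_isTrivialRelation ?_
  intro l
  induction l with
  | zero =>
    intro f x _
    exact ⟨0, fun i => i.elim0, fun j => j.elim0, fun i => i.elim0, fun j => j.elim0⟩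
  | succ l ih =>
    intro f x hfx
    rw [Fin.sum_univ_castSucc] at hfx
    set I : Ideal S := Ideal.span (Set.range fun i : Fin l => f i.castSucc) with hI
    have hmem : f (Fin.last l) • x (Fin.last l) ∈ I • (⊤ : Submodule S M) := by
      rw [eq_neg_of_add_eq_zero_right hfx]
      exact neg_mem (Submodule.sum_mem _ fun i _ =>
        Submodule.smul_mem_smul (Ideal.subset_span ⟨i, rfl⟩) trivial)
    have hx := h I _ _ hmem
    have htop : (⊤ : Submodule S M) = Submodule.span S (Set.range (id : M → M)) := by
      rw [Set.range_id, Submodule.span_univ]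
    rw [htop, Submodule.mem_ideal_smul_span_iff_exists_sum] at hx
    obtain ⟨c', hc', hx⟩ := hx
    let e := c'.support.equivFin.symm
    set k := c'.support.card
    let c (j : Fin k) : S := c' (e j)
    let y (j : Fin k) : M := e j
    have hxl : x (Fin.last l) = ∑ j, c j • y j := by
      rw [← hx, Finsupp.sum, ← Finset.sum_coe_sort, ← Equiv.sum_comp e]
      rfl
    have hd (j : Fin k) : ∃ d : Fin l → S, ∑ i, d i * f i.castSucc = c j * f (Fin.last l) := by
      have := hc' (e j)
      rw [Submodule.mem_colon_singleton, smul_eq_mul] at this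
      exact Ideal.mem_span_range_iff_exists_fun.1 this
    choose d hd using hd
    -- substituting for the last element gives a relation of length `l`
    have hrel : ∑ i : Fin l, f i.castSucc • (x i.castSucc + ∑ j, d j i • y j) = 0 := by
      rw [← hfx, hxl]
      simp only [smul_add, Finset.smul_sum, Finset.sum_add_distrib, smul_smul]
      rw [Finset.sum_comm]
      congr 1
      refine Finset.sum_congr rfl fun j _ => ?_
      rw [← Finset.sum_smul, mul_comm (f (Fin.last l)), ← hd j]
      simp only [mul_comm]
    obtain ⟨k', a, z, hxz, ha⟩ := ih hrel
    refine ⟨k' + k, Fin.lastCases (Fin.append 0 c) fun i => Fin.append (a i) fun j => -d j i,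
      Fin.append z y, fun i => ?_, fun j => ?_⟩
    · refine Fin.lastCases ?_ (fun i => ?_) i
      · simp [Fin.sum_univ_add, hxl]
      · simp [Fin.sum_univ_add, ← hxz i]
    · rw [Fin.sum_univ_castSucc]
      refine Fin.addCases (fun j => ?_) (fun j => ?_) j
      · simp [ha j]
      · simp only [Fin.lastCases_castSucc, Fin.lastCases_last, Fin.append_right, mul_neg,
          Finset.sum_neg_distrib]
        rw [mul_comm (f (Fin.last l)), ← hd j]
        simp only [mul_comm, neg_add_cancel]

end Module.Flat

section RegularModulo

variable {B : Type*} [CommRing B]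

/-- `f` is a nonzerodivisor modulo the ideal `J`. -/
def IsRegularModulo (J : Ideal B) (f : B) : Prop := ∀ b, f * b ∈ J → b ∈ J

theorem Ideal.mem_of_forall_mem_sup_pow [IsLocalRing B] [IsNoetherianRing B] (J : Ideal B) (b : B)
    (h : ∀ n, b ∈ J ⊔ maximalIdeal B ^ n) : b ∈ J := by
  rw [← Ideal.Quotient.eq_zero_iff_mem]
  refine IsHausdorff.haus (I := maximalIdeal B) (M := B ⧸ J) inferInstance _ fun n => ?_
  rw [SModEq.zero]
  obtain ⟨j, hj, c, hc, rfl⟩ := Submodule.mem_sup.1 (h n)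
  rw [map_add, Ideal.Quotient.eq_zero_iff_mem.2 hj, zero_add]
  have : (Ideal.Quotient.mk J) c = c • (1 : B ⧸ J) := by
    rw [Algebra.smul_def, mul_one]; rfl
  rw [this]
  exact Submodule.smul_mem_smul hc trivial

variable {S : Type*} [CommRing S] [Algebra S B]

variable (S) in
/-- A reformulation of flatness of `B ⧸ J` over `S` in terms of ideals of `B`, see
`FlatModulo.flat_quotient`: colon ideals by elements of `S` extend to `B ⧸ J`. -/
def FlatModulo (J : Ideal B) : Prop :=
  ∀ (I : Ideal S) (s : S) (b : B), algebraMap S B s * b ∈ I.map (algebraMap S B) ⊔ J →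
    b ∈ (I.colon {s} : Ideal S).map (algebraMap S B) ⊔ J

theorem FlatModulo.flat_quotient {J : Ideal B} (h : FlatModulo S J) : Module.Flat S (B ⧸ J) := by
  have key (I : Ideal S) (b : B) : Ideal.Quotient.mk J b ∈ I • (⊤ : Submodule S (B ⧸ J)) ↔
      b ∈ I.map (algebraMap S B) ⊔ J := by
    rw [Ideal.smul_top_eq_map, Submodule.restrictScalars_mem,
      IsScalarTower.algebraMap_eq S B (B ⧸ J), ← Ideal.map_map, ← Ideal.mem_comap]
    change b ∈ Ideal.comap (Ideal.Quotient.mk J) (Ideal.map (Ideal.Quotient.mk J) _) ↔ _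
    rw [Ideal.comap_map_of_surjective _ Ideal.Quotient.mk_surjective, ← RingHom.ker_eq_comap_bot,
      Ideal.mk_ker]
  refine Module.Flat.of_forall_colon fun I s m hm => ?_
  obtain ⟨b, rfl⟩ := Ideal.Quotient.mk_surjective m
  have e : s • Ideal.Quotient.mk J b = Ideal.Quotient.mk J (algebraMap S B s * b) := by
    rw [Algebra.smul_def, map_mul]; rfl
  rw [e, key] at hm
  rw [key]
  exact h I s b hm

theorem Ideal.mem_map_sup_span_singleton_iff {I : Ideal S} {J : Ideal B} {s : S} {b : B} :
    b ∈ (I ⊔ Ideal.span {s}).map (algebraMap S B) ⊔ J ↔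
      ∃ i ∈ I.map (algebraMap S B) ⊔ J, ∃ c, b = i + algebraMap S B s * c := by
  rw [Ideal.map_sup, Ideal.map_span, Set.image_singleton, sup_right_comm, Submodule.mem_sup]
  constructor
  · rintro ⟨i, hi, c, hc, rfl⟩
    obtain ⟨c, rfl⟩ := Ideal.mem_span_singleton.1 hc
    exact ⟨i, hi, c, rfl⟩
  · rintro ⟨i, hi, c, rfl⟩
    exact ⟨i, hi, _, Ideal.mem_span_singleton.2 ⟨c, rfl⟩, rfl⟩

variable [IsLocalRing S] [IsNoetherianRing S]

/-- If `B ⧸ J` is flat over `S` and `f` is a nonzerodivisor on its closed fibre, then `f` is a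
nonzerodivisor on the fibre over every `S ⧸ I` with `I` primary to the maximal ideal. The proof is
by noetherian induction on `I`. -/
theorem FlatModulo.isRegularModulo_of_pow_le {J : Ideal B} (h : FlatModulo S J) {f : B}
    (hf : IsRegularModulo ((maximalIdeal S).map (algebraMap S B) ⊔ J) f) (I : Ideal S)
    (hI : ∃ n, maximalIdeal S ^ n ≤ I) : IsRegularModulo (I.map (algebraMap S B) ⊔ J) f := by
  classical
  induction I using WellFoundedGT.induction with
  | ind I ih =>
  by_cases htop : I = ⊤
  · intro b _
    simp [htop, Ideal.map_top]
  -- an element `r` of the socle of `S ⧸ I`; the claim is known for the larger ideal `I ⊔ (r)`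
  obtain ⟨r, hrI, hr⟩ : ∃ r, r ∉ I ∧ ∀ m ∈ maximalIdeal S, m * r ∈ I := by
    have hpos : Nat.find hI ≠ 0 := by
      intro h0
      have := Nat.find_spec hI
      rw [h0, pow_zero, Ideal.one_eq_top, top_le_iff] at this
      exact htop this
    obtain ⟨k, hk⟩ := Nat.exists_eq_succ_of_ne_zero hpos
    have hnot := Nat.find_min hI (m := k) (by omega)
    obtain ⟨r, hr, hrI⟩ := SetLike.not_le_iff_exists.1 hnot
    refine ⟨r, hrI, fun m hm => ?_⟩
    have := Nat.find_spec hI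
    rw [hk, Nat.succ_eq_add_one, pow_succ'] at this
    exact this (Ideal.mul_mem_mul hm hr)
  have hlt : I < I ⊔ Ideal.span {r} := by
    refine lt_of_le_of_ne le_sup_left fun he => hrI ?_
    rw [he]
    exact Ideal.mem_sup_right (Ideal.mem_span_singleton_self r)
  have hI' : ∃ n, maximalIdeal S ^ n ≤ I ⊔ Ideal.span {r} := by
    obtain ⟨n, hn⟩ := hI
    exact ⟨n, hn.trans hlt.le⟩
  have hreg : IsRegularModulo ((I ⊔ Ideal.span {r}).map (algebraMap S B) ⊔ J) f :=
    ih _ hlt hI'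
  intro b hb
  have hmono {I₁ I₂ : Ideal S} (h12 : I₁ ≤ I₂) :
      I₁.map (algebraMap S B) ⊔ J ≤ I₂.map (algebraMap S B) ⊔ J :=
    sup_le_sup_right (Ideal.map_mono h12) J
  have hb' : b ∈ (I ⊔ Ideal.span {r}).map (algebraMap S B) ⊔ J := hreg b (hmono le_sup_left hb)
  obtain ⟨i, hi, c, rfl⟩ := Ideal.mem_map_sup_span_singleton_iff.1 hb'
  have hfc : algebraMap S B r * (f * c) ∈ I.map (algebraMap S B) ⊔ J := by
    have e : algebraMap S B r * (f * c) = f * (i + algebraMap S B r * c) - f * i := by ring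
    rw [e]
    exact sub_mem hb (Ideal.mul_mem_left _ _ hi)
  have hcolon : (I.colon {r} : Ideal S) ≤ maximalIdeal S := by
    refine le_maximalIdeal fun he => hrI ?_
    have : (1 : S) ∈ (I.colon {r} : Ideal S) := he ▸ trivial
    simpa [Submodule.mem_colon_singleton] using this
  have hc : c ∈ (maximalIdeal S).map (algebraMap S B) ⊔ J :=
    hf c (hmono hcolon (h I r _ hfc))
  refine add_mem hi ?_
  set K : Ideal B := I.map (algebraMap S B) ⊔ J with hK
  have hle : (maximalIdeal S).map (algebraMap S B) ⊔ J ≤ K.colon {algebraMap S B r} := by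
    refine sup_le (Ideal.map_le_iff_le_comap.2 fun m hm => ?_) fun j hj => ?_
    · rw [Ideal.mem_comap, Submodule.mem_colon_singleton, smul_eq_mul, ← map_mul]
      exact Ideal.mem_sup_left (Ideal.mem_map_of_mem _ (hr m hm))
    · rw [Submodule.mem_colon_singleton, smul_eq_mul]
      exact Ideal.mem_sup_right (J.mul_mem_right _ hj)
  have := Submodule.mem_colon_singleton.1 (hle hc)
  rwa [smul_eq_mul, mul_comm] at this

variable [IsLocalRing B] [IsNoetherianRing B]

/-- Passing to the limit over `I ⊔ 𝔪 ^ n`, the nonzerodivisor property extends to all ideals `I`. -/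
theorem FlatModulo.isRegularModulo {J : Ideal B} (h : FlatModulo S J) {f : B}
    (hloc : (maximalIdeal S).map (algebraMap S B) ≤ maximalIdeal B)
    (hf : IsRegularModulo ((maximalIdeal S).map (algebraMap S B) ⊔ J) f) (I : Ideal S) :
    IsRegularModulo (I.map (algebraMap S B) ⊔ J) f := by
  intro b hb
  refine Ideal.mem_of_forall_mem_sup_pow _ _ fun n => ?_
  have := h.isRegularModulo_of_pow_le hf (I ⊔ maximalIdeal S ^ n) ⟨n, le_sup_right⟩ b
    (sup_le_sup_right (Ideal.map_mono le_sup_left) J hb)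
  rw [Ideal.map_sup, Ideal.map_pow, sup_right_comm] at this
  exact sup_le_sup_left (Ideal.pow_right_mono hloc n) _ this

/-- Flatness is preserved on dividing by an element which is a nonzerodivisor on the closed
fibre. -/
theorem FlatModulo.sup_span_singleton {J : Ideal B} (h : FlatModulo S J) {f : B}
    (hloc : (maximalIdeal S).map (algebraMap S B) ≤ maximalIdeal B)
    (hf : IsRegularModulo ((maximalIdeal S).map (algebraMap S B) ⊔ J) f) :
    FlatModulo S (J ⊔ Ideal.span {f}) := by
  intro I s b hb
  rw [← sup_assoc] at hb ⊢
  obtain ⟨i, hi, c, hc, e⟩ := Submodule.mem_sup.1 hb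
  obtain ⟨b₁, rfl⟩ := Ideal.mem_span_singleton.1 hc
  have hb₁ : f * b₁ ∈ (I ⊔ Ideal.span {s}).map (algebraMap S B) ⊔ J :=
    Ideal.mem_map_sup_span_singleton_iff.2 ⟨-i, neg_mem hi, b, by rw [← e]; ring⟩
  obtain ⟨i', hi', b₂, rfl⟩ :=
    Ideal.mem_map_sup_span_singleton_iff.1 (h.isRegularModulo hloc hf _ _ hb₁)
  have hmem : algebraMap S B s * (b - f * b₂) ∈ I.map (algebraMap S B) ⊔ J := by
    have e' : algebraMap S B s * (b - f * b₂) = i + f * i' := by linear_combination -e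
    rw [e']
    exact add_mem hi (Ideal.mul_mem_left _ _ hi')
  rw [← sub_add_cancel b (f * b₂)]
  exact add_mem (Ideal.mem_sup_left (h I s _ hmem))
    (Ideal.mem_sup_right (Ideal.mem_span_singleton.2 ⟨b₂, rfl⟩))

end RegularModulo

namespace MvPowerSeries

theorem mem_map_C_iff {σ S : Type*} [CommRing S] {I : Ideal S} (hI : I.FG)
    {f : MvPowerSeries σ S} : f ∈ I.map (C (σ := σ)) ↔ ∀ d, coeff d f ∈ I := by
  classical
  constructor
  · intro hf d
    refine Submodule.span_induction (p := fun f _ => ∀ d, coeff d f ∈ I) ?_ ?_ ?_ ?_ hf d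
    · rintro _ ⟨a, ha, rfl⟩ d
      rw [coeff_C]
      split_ifs
      · exact ha
      · exact zero_mem I
    · simp
    · intro x y _ _ hx hy d
      rw [map_add]
      exact add_mem (hx d) (hy d)
    · intro a x _ hx d
      rw [smul_eq_mul, coeff_mul]
      exact Ideal.sum_mem _ fun e _ => Ideal.mul_mem_left _ _ (hx _)
  · intro hf
    obtain ⟨n, g, rfl⟩ := Submodule.fg_iff_exists_fin_generating_family.1 hI
    have h (d) := Ideal.mem_span_range_iff_exists_fun.1 (hf d)
    choose c hc using h
    let F (i : Fin n) : MvPowerSeries σ S := fun d => c d i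
    have hF (i d) : coeff d (F i) = c d i := rfl
    have : f = ∑ i, F i * C (g i) := by
      ext d
      simp [map_sum, coeff_mul_C, hF, hc]
    rw [this]
    exact Ideal.sum_mem _ fun i _ => Ideal.mul_mem_left _ _
      (Ideal.mem_map_of_mem _ (Ideal.subset_span ⟨i, rfl⟩))

theorem flatModulo_bot (σ S : Type*) [CommRing S] [IsNoetherianRing S] :
    FlatModulo S (⊥ : Ideal (MvPowerSeries σ S)) := by
  intro I s f hf
  rw [sup_bot_eq] at hf ⊢
  have hf' := (mem_map_C_iff (IsNoetherian.noetherian I)).1 hf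
  refine (mem_map_C_iff (IsNoetherian.noetherian _)).2 fun d => ?_
  have := hf' d
  rw [algebraMap_apply, Algebra.algebraMap_self, RingHom.id_apply, coeff_C_mul] at this
  rw [Submodule.mem_colon_singleton, smul_eq_mul, mul_comm]
  exact this

end MvPowerSeries

/-! ### A regular sequence of three quadrics -/

section RegularModulo

open RingTheory.Sequence

variable {B : Type*} [CommRing B] {J : Ideal B} {f g x : B}

theorem isWeaklyRegular_concat_iff {l : List B} :
    IsWeaklyRegular B (l ++ [f]) ↔ IsWeaklyRegular B l ∧ IsRegularModulo (Ideal.ofList l) f := by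
  rw [isWeaklyRegular_append_iff, isWeaklyRegular_singleton_iff,
    isSMulRegular_quotient_iff_mem_of_smul_mem, smul_eq_mul, Ideal.mul_top]
  rfl

theorem Ideal.ofList_concat (l : List B) (f : B) :
    Ideal.ofList (l ++ [f]) = Ideal.ofList l ⊔ Ideal.span {f} := by
  rw [Ideal.ofList_append, Ideal.ofList_singleton]

theorem IsUnit.isRegularModulo (hf : IsUnit f) (J : Ideal B) : IsRegularModulo J f :=
  fun _ hb => (Ideal.unit_mul_mem_iff_mem J hf).1 hb

theorem IsRegularModulo.mul (hf : IsRegularModulo J f) (hg : IsRegularModulo J g) :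
    IsRegularModulo J (f * g) := fun b hb => hg b (hf _ (by rwa [← mul_assoc]))

theorem IsRegularModulo.congr (hf : IsRegularModulo J f) (h : f - g ∈ J) :
    IsRegularModulo J g := by
  intro b hb
  refine hf b ?_
  have e : f * b = (f - g) * b + g * b := by ring
  rw [e]
  exact add_mem (J.mul_mem_right _ h) hb

theorem Ideal.sup_span_singleton_congr (h : f - g ∈ J) :
    J ⊔ Ideal.span {f} = J ⊔ Ideal.span {g} := by
  have key : ∀ f g : B, f - g ∈ J → J ⊔ Ideal.span {f} ≤ J ⊔ Ideal.span {g} := by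
    intro f g h
    refine sup_le le_sup_left ?_
    rw [Ideal.span_singleton_le_iff_mem, ← sub_add_cancel f g]
    exact add_mem (Ideal.mem_sup_left h) (Ideal.mem_sup_right (Ideal.mem_span_singleton_self g))
  exact le_antisymm (key f g h) (key g f (by rw [← neg_sub]; exact neg_mem h))

/-- If `x, g` is a regular sequence, then so is `x ^ 2, g`. -/
theorem IsRegularModulo.sup_span_sq (hx : IsRegularModulo J x)
    (hg : IsRegularModulo (J ⊔ Ideal.span {x}) g) :
    IsRegularModulo (J ⊔ Ideal.span {x ^ 2}) g := by
  have hle : J ⊔ Ideal.span {x ^ 2} ≤ J ⊔ Ideal.span {x} :=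
    sup_le_sup_left (Ideal.span_singleton_le_span_singleton.2 ⟨x, by ring⟩) J
  intro b hb
  obtain ⟨j, hj, c, hc, rfl⟩ := Submodule.mem_sup.1 (hg b (hle hb))
  obtain ⟨c, rfl⟩ := Ideal.mem_span_singleton.1 hc
  obtain ⟨j', hj', d, hd, e⟩ := Submodule.mem_sup.1 hb
  obtain ⟨d, rfl⟩ := Ideal.mem_span_singleton.1 hd
  have h1 : x * (g * c - x * d) ∈ J := by
    have e' : x * (g * c - x * d) = j' - g * j := by linear_combination -e
    rw [e']
    exact sub_mem hj' (J.mul_mem_left _ hj)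
  have h2 : g * c ∈ J ⊔ Ideal.span {x} := by
    rw [← sub_add_cancel (g * c) (x * d)]
    exact add_mem (Ideal.mem_sup_left (hx _ h1))
      (Ideal.mem_sup_right (Ideal.mem_span_singleton.2 ⟨d, rfl⟩))
  obtain ⟨j₂, hj₂, c₂, hc₂, e₂⟩ := Submodule.mem_sup.1 (hg c h2)
  obtain ⟨c₂, rfl⟩ := Ideal.mem_span_singleton.1 hc₂
  have e₃ : j + x * c = (j + x * j₂) + x ^ 2 * c₂ := by rw [← e₂]; ring
  rw [e₃]
  exact add_mem (Ideal.mem_sup_left (add_mem hj (J.mul_mem_left _ hj₂)))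
    (Ideal.mem_sup_right (Ideal.mem_span_singleton.2 ⟨c₂, rfl⟩))

end RegularModulo

namespace MvPowerSeries

open RingTheory.Sequence

variable {σ k : Type*}

theorem mem_span_X_image_iff [CommRing k] (T : Finset σ) {f : MvPowerSeries σ k} :
    f ∈ Ideal.span ((X : σ → MvPowerSeries σ k) '' T) ↔
      ∀ d : σ →₀ ℕ, (∀ i ∈ T, d i = 0) → coeff d f = 0 := by
  classical
  constructor
  · intro hf
    refine Submodule.span_induction (p := fun f _ =>
      ∀ d : σ →₀ ℕ, (∀ i ∈ T, d i = 0) → coeff d f = 0) ?_ ?_ ?_ ?_ hf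
    · rintro _ ⟨i, hi, rfl⟩ d hd
      exact X_dvd_iff.1 dvd_rfl d (hd i hi)
    · simp
    · intro x y _ _ hx hy d hd
      rw [map_add, hx d hd, hy d hd, add_zero]
    · intro a x _ hx d hd
      rw [smul_eq_mul, coeff_mul]
      refine Finset.sum_eq_zero fun e he => ?_
      rw [Finset.HasAntidiagonal.mem_antidiagonal] at he
      rw [hx e.2 (fun i hi => ?_), mul_zero]
      have := hd i hi
      rw [← he, Finsupp.add_apply] at this
      omega
  · induction T using Finset.induction_on generalizing f with
    | empty =>
      intro hf
      have : f = 0 := by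
        ext d
        exact hf d (by simp)
      rw [this]
      exact zero_mem _
    | insert s T hs ih =>
      intro hf
      let r : MvPowerSeries σ k := fun d => if d s = 0 then coeff d f else 0
      have hr (d) : coeff d r = if d s = 0 then coeff d f else 0 := rfl
      rw [Finset.coe_insert, Set.image_insert_eq, Ideal.span_insert, ← sub_add_cancel f r]
      refine add_mem (Ideal.mem_sup_left ?_) (Ideal.mem_sup_right (ih fun d hd => ?_))
      · rw [Ideal.mem_span_singleton, X_dvd_iff]
        intro d hd
        rw [map_sub, hr, if_pos hd, sub_self]
      · rw [hr]
        split_ifs with h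
        · refine hf d fun i hi => ?_
          rcases Finset.mem_insert.1 hi with rfl | hi
          · exact h
          · exact hd i hi
        · rfl

theorem isRegularModulo_span_X_image [CommRing k] {T : Finset σ} {i : σ} (hi : i ∉ T) :
    IsRegularModulo (Ideal.span ((X : σ → MvPowerSeries σ k) '' T)) (X i) := by
  intro b hb
  rw [mem_span_X_image_iff] at hb ⊢
  intro d hd
  have := hb (Finsupp.single i 1 + d) fun j hj => by
    have : i ≠ j := fun h => hi (h ▸ hj)
    simp [hd j hj, this]
  rwa [X, coeff_add_monomial_mul, one_mul] at this

theorem isWeaklyRegular_map_X [CommRing k] (l : List σ) (hl : l.Nodup) :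
    IsWeaklyRegular (MvPowerSeries σ k) (l.map (X : σ → MvPowerSeries σ k)) := by
  classical
  induction l using List.reverseRecOn with
  | nil => exact IsWeaklyRegular.nil _ _
  | append_singleton l i ih =>
    have hl' := List.nodup_append.1 hl
    rw [List.map_append, List.map_singleton, isWeaklyRegular_concat_iff]
    refine ⟨ih hl'.1, ?_⟩
    have e : Ideal.ofList (l.map (X : σ → MvPowerSeries σ k)) =
        Ideal.span ((X : σ → MvPowerSeries σ k) '' (l.toFinset : Finset σ)) := by
      rw [Ideal.ofList]
      congr 1
      ext f
      simp
    rw [e]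
    refine isRegularModulo_span_X_image fun h => ?_
    exact hl'.2.2 i (List.mem_toFinset.1 h) i (by simp) rfl

end MvPowerSeries

namespace FramedRing

open RingTheory.Sequence MvPowerSeries

variable {k : Type*} [Field k]

/-- The quadric `x₁₁² + x₁₂ x₂₁`, with `x₁₂ = X 1 + α`. -/
noncomputable def quadric₁ {k : Type*} [CommRing k] (α : k) : MvPowerSeries (Fin 6) k :=
  X 0 ^ 2 + (X 1 + C α) * X 2

/-- The quadric `y₁₁² + y₁₂ y₂₁`, with `y₁₂ = X 4 + β`. -/
noncomputable def quadric₂ {k : Type*} [CommRing k] (β : k) : MvPowerSeries (Fin 6) k :=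
  X 3 ^ 2 + (X 4 + C β) * X 5

/-- The quadric `x₁₂ y₂₁ + 2 x₁₁ y₁₁ + x₂₁ y₁₂`. -/
noncomputable def quadric₃ {k : Type*} [CommRing k] (α β : k) : MvPowerSeries (Fin 6) k :=
  (X 1 + C α) * X 5 + 2 * X 0 * X 3 + X 2 * (X 4 + C β)

theorem quadric_mem_maximalIdeal (α β : k) :
    quadric₁ α ∈ maximalIdeal (MvPowerSeries (Fin 6) k) ∧
    quadric₂ β ∈ maximalIdeal (MvPowerSeries (Fin 6) k) ∧
    quadric₃ α β ∈ maximalIdeal (MvPowerSeries (Fin 6) k) := by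
  simp only [MvPowerSeries.mem_maximalIdeal_iff]
  simp [quadric₁, quadric₂, quadric₃]

/-- A step for comparing regular sequences that generate the same ideals: the last element may be
changed by a unit and modulo the preceding elements. -/
theorem isWeaklyRegular_replace {B : Type*} [CommRing B] {l l' : List B} {x g u : B}
    (h : IsWeaklyRegular B (l ++ [x])) (hl' : IsWeaklyRegular B l')
    (e : Ideal.ofList l' = Ideal.ofList l) (hu : IsUnit u) (hg : u * x - g ∈ Ideal.ofList l) :
    IsWeaklyRegular B (l' ++ [g]) ∧ Ideal.ofList (l' ++ [g]) = Ideal.ofList (l ++ [x]) := by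
  rw [isWeaklyRegular_concat_iff] at h ⊢
  rw [Ideal.ofList_concat, Ideal.ofList_concat, e]
  refine ⟨⟨hl', ((hu.isRegularModulo _).mul h.2).congr hg⟩, ?_⟩
  rw [← Ideal.sup_span_singleton_congr hg, Ideal.span_singleton_mul_left_unit hu]

/-- Modulo three suitable variables the quadrics are, up to units, two other variables and a
square. -/
theorem isWeaklyRegular_quadrics_of_left_ne_zero {α : k} (hα : α ≠ 0) (β : k) :
    IsWeaklyRegular (MvPowerSeries (Fin 6) k) [quadric₁ α, quadric₂ β, quadric₃ α β] := by
  have hu : IsUnit (C α : MvPowerSeries (Fin 6) k) := (isUnit_iff_ne_zero.2 hα).map C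
  have h : IsWeaklyRegular (MvPowerSeries (Fin 6) k) ([X 0, X 1, X 4] ++ [X 2] ++ [X 5] ++ [X 3] :
      List (MvPowerSeries (Fin 6) k)) :=
    isWeaklyRegular_map_X ([0, 1, 4, 2, 5, 3] : List (Fin 6)) (by decide)
  have h₅ := (isWeaklyRegular_concat_iff.1 h).1
  have h₂ := (isWeaklyRegular_concat_iff.1 h₅).1
  have h₀ := (isWeaklyRegular_concat_iff.1 h₂).1
  obtain ⟨r₁, e₁⟩ := isWeaklyRegular_replace (g := quadric₁ α) h₂ h₀ rfl hu (by
    have e : C α * X 2 - quadric₁ α = -X 0 * X 0 + -X 2 * X 1 := by rw [quadric₁]; ring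
    rw [e]
    exact add_mem (Ideal.mul_mem_left _ _ (Ideal.subset_span (by simp)))
      (Ideal.mul_mem_left _ _ (Ideal.subset_span (by simp))))
  obtain ⟨r₃, e₃⟩ := isWeaklyRegular_replace (g := quadric₃ α β) h₅ r₁ e₁ hu (by
    have e : C α * X 5 - quadric₃ α β = -X 5 * X 1 + -2 * X 3 * X 0 + -(X 4 + C β) * X 2 := by
      rw [quadric₃]; ring
    rw [e]
    exact add_mem (add_mem (Ideal.mul_mem_left _ _ (Ideal.subset_span (by simp)))
      (Ideal.mul_mem_left _ _ (Ideal.subset_span (by simp))))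
      (Ideal.mul_mem_left _ _ (Ideal.subset_span (by simp))))
  have h₃ : IsWeaklyRegular (MvPowerSeries (Fin 6) k)
      ([X 0, X 1, X 4] ++ [X 2] ++ [X 5] ++ [X 3 * X 3] :
      List (MvPowerSeries (Fin 6) k)) := by
    rw [isWeaklyRegular_concat_iff] at h ⊢
    exact ⟨h.1, h.2.mul h.2⟩
  obtain ⟨r₂, -⟩ := isWeaklyRegular_replace (g := quadric₂ β) h₃ r₃ e₃ isUnit_one (by
    have e : 1 * (X 3 * X 3) - quadric₂ β = -(X 4 + C β) * X 5 := by rw [quadric₂]; ring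
    rw [e]
    exact Ideal.mul_mem_left _ _ (Ideal.subset_span (by simp)))
  have hmem := quadric_mem_maximalIdeal α β
  refine ((isWeaklyRegular_append_iff _ [quadric₁ α, quadric₂ β, quadric₃ α β] [X 0, X 1, X 4]).1
    (isWeaklyRegular_of_perm_of_subset_maximalIdeal r₂ ?_ ?_)).1
  · simp only [List.cons_append, List.nil_append]
    exact (List.perm_append_comm (l₁ := [X 0, X 1, X 4])
      (l₂ := [quadric₁ α, quadric₃ α β, quadric₂ β])).trans
      ((List.Perm.swap _ _ _).cons _)
  · simp only [List.cons_append, List.nil_append, List.mem_cons, List.not_mem_nil, or_false]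
    rintro r (rfl | rfl | rfl | rfl | rfl | rfl) <;>
      first | exact X_mem_maximalIdeal _ | simp only [hmem]

/-- The case symmetric to `isWeaklyRegular_quadrics_of_left_ne_zero`. -/
theorem isWeaklyRegular_quadrics_of_right_ne_zero (α : k) {β : k} (hβ : β ≠ 0) :
    IsWeaklyRegular (MvPowerSeries (Fin 6) k) [quadric₁ α, quadric₂ β, quadric₃ α β] := by
  have hu : IsUnit (C β : MvPowerSeries (Fin 6) k) := (isUnit_iff_ne_zero.2 hβ).map C
  have h : IsWeaklyRegular (MvPowerSeries (Fin 6) k) ([X 3, X 4, X 1] ++ [X 5] ++ [X 2] ++ [X 0] :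
      List (MvPowerSeries (Fin 6) k)) :=
    isWeaklyRegular_map_X ([3, 4, 1, 5, 2, 0] : List (Fin 6)) (by decide)
  have h₂ := (isWeaklyRegular_concat_iff.1 h).1
  have h₅ := (isWeaklyRegular_concat_iff.1 h₂).1
  have h₀ := (isWeaklyRegular_concat_iff.1 h₅).1
  obtain ⟨r₂, e₂⟩ := isWeaklyRegular_replace (g := quadric₂ β) h₅ h₀ rfl hu (by
    have e : C β * X 5 - quadric₂ β = -X 3 * X 3 + -X 5 * X 4 := by rw [quadric₂]; ring
    rw [e]
    exact add_mem (Ideal.mul_mem_left _ _ (Ideal.subset_span (by simp)))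
      (Ideal.mul_mem_left _ _ (Ideal.subset_span (by simp))))
  obtain ⟨r₃, e₃⟩ := isWeaklyRegular_replace (g := quadric₃ α β) h₂ r₂ e₂ hu (by
    have e : C β * X 2 - quadric₃ α β = -X 2 * X 4 + -2 * X 0 * X 3 + -(X 1 + C α) * X 5 := by
      rw [quadric₃]; ring
    rw [e]
    exact add_mem (add_mem (Ideal.mul_mem_left _ _ (Ideal.subset_span (by simp)))
      (Ideal.mul_mem_left _ _ (Ideal.subset_span (by simp))))
      (Ideal.mul_mem_left _ _ (Ideal.subset_span (by simp))))
  have h₁ : IsWeaklyRegular (MvPowerSeries (Fin 6) k)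
      ([X 3, X 4, X 1] ++ [X 5] ++ [X 2] ++ [X 0 * X 0] :
      List (MvPowerSeries (Fin 6) k)) := by
    rw [isWeaklyRegular_concat_iff] at h ⊢
    exact ⟨h.1, h.2.mul h.2⟩
  obtain ⟨r₁, -⟩ := isWeaklyRegular_replace (g := quadric₁ α) h₁ r₃ e₃ isUnit_one (by
    have e : 1 * (X 0 * X 0) - quadric₁ α = -(X 1 + C α) * X 2 := by rw [quadric₁]; ring
    rw [e]
    exact Ideal.mul_mem_left _ _ (Ideal.subset_span (by simp)))
  have hmem := quadric_mem_maximalIdeal α β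
  refine ((isWeaklyRegular_append_iff _ [quadric₁ α, quadric₂ β, quadric₃ α β] [X 3, X 4, X 1]).1
    (isWeaklyRegular_of_perm_of_subset_maximalIdeal r₁ ?_ ?_)).1
  · simp only [List.cons_append, List.nil_append]
    exact (List.perm_append_comm (l₁ := [X 3, X 4, X 1])
      (l₂ := [quadric₂ β, quadric₃ α β, quadric₁ α])).trans
      ((List.perm_append_comm (l₁ := [quadric₂ β, quadric₃ α β])
        (l₂ := [quadric₁ α])).append_right _)
  · simp only [List.cons_append, List.nil_append, List.mem_cons, List.not_mem_nil, or_false]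
    rintro r (rfl | rfl | rfl | rfl | rfl | rfl) <;>
      first | exact X_mem_maximalIdeal _ | simp only [hmem]

/-- If `ρ(γ)` and `ρ(δ)` are both trivial, the closed fibre is the cone of pairs of proportional
nilpotent matrices of trace zero. The linear forms `x₁₂`, `y₂₁` and `y₁₂ - x₂₁` have only the
trivial zero on this cone; modulo these forms the quadrics are `x₁₁²`, `y₁₁²` and
`2 x₁₁ y₁₁ + x₂₁²`. -/
theorem isWeaklyRegular_quadrics_zero :
    IsWeaklyRegular (MvPowerSeries (Fin 6) k)
      [quadric₁ (0 : k), quadric₂ (0 : k), quadric₃ (0 : k) 0] := by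
  set L : List (MvPowerSeries (Fin 6) k) := [X 1, X 5, X 4 - X 2] with hL
  set J := Ideal.ofList L with hJ
  have h1 : X 1 ∈ J := Ideal.subset_span (by simp [hL])
  have h5 : X 5 ∈ J := Ideal.subset_span (by simp [hL])
  have h42 : X 4 - X 2 ∈ J := Ideal.subset_span (by simp [hL])
  have hX : IsWeaklyRegular (MvPowerSeries (Fin 6) k)
      ([X 1, X 5] ++ ([X 3, X 0, X 2] ++ [X 4 - X 2]) :
      List (MvPowerSeries (Fin 6) k)) := by
    have h : IsWeaklyRegular (MvPowerSeries (Fin 6) k) ([X 1, X 5, X 3, X 0, X 2] ++ [X 4] :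
      List (MvPowerSeries (Fin 6) k)) :=
      isWeaklyRegular_map_X ([1, 5, 3, 0, 2, 4] : List (Fin 6)) (by decide)
    refine (isWeaklyRegular_replace (g := X 4 - X 2) h (isWeaklyRegular_concat_iff.1 h).1 rfl
      isUnit_one ?_).1
    rw [one_mul, sub_sub_cancel]
    exact Ideal.subset_span (by simp)
  have hXm : ∀ r ∈ ([X 1, X 5] ++ ([X 3, X 0, X 2] ++ [X 4 - X 2]) :
      List (MvPowerSeries (Fin 6) k)), r ∈ maximalIdeal (MvPowerSeries (Fin 6) k) := by
    simp only [List.cons_append, List.nil_append, List.mem_cons, List.not_mem_nil, or_false]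
    rintro r (rfl | rfl | rfl | rfl | rfl | rfl) <;>
      first | exact X_mem_maximalIdeal _
            | exact sub_mem (X_mem_maximalIdeal _) (X_mem_maximalIdeal _)
  have hA : IsWeaklyRegular (MvPowerSeries (Fin 6) k) (L ++ [X 3] ++ [X 0] ++ [X 2]) :=
    isWeaklyRegular_of_perm_of_subset_maximalIdeal hX
      (List.perm_append_comm.append_left [X 1, X 5]) hXm
  have hB : IsWeaklyRegular (MvPowerSeries (Fin 6) k) (L ++ [X 0] ++ [X 3] ++ [X 2]) :=
    isWeaklyRegular_of_perm_of_subset_maximalIdeal hX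
      ((List.perm_append_comm.append_left [X 1, X 5]).trans
        ((List.Perm.swap (X 0) (X 3) [X 2]).append_left [X 1, X 5, X 4 - X 2])) hXm
  simp only [isWeaklyRegular_concat_iff, Ideal.ofList_concat, ← hJ] at hA hB
  obtain ⟨⟨⟨hLr, a₃⟩, a₀⟩, a₂⟩ := hA
  obtain ⟨⟨⟨-, b₀⟩, b₃⟩, -⟩ := hB
  have e₁ : X 0 ^ 2 - quadric₁ 0 ∈ J := by
    have e : X 0 ^ 2 - quadric₁ (0 : k) = -X 2 * X 1 := by rw [quadric₁, map_zero]; ring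
    rw [e]
    exact J.mul_mem_left _ h1
  have e₂ : X 3 ^ 2 - quadric₂ 0 ∈ J := by
    have e : X 3 ^ 2 - quadric₂ (0 : k) = -X 4 * X 5 := by rw [quadric₂, map_zero]; ring
    rw [e]
    exact J.mul_mem_left _ h5
  have c₃ : IsRegularModulo (J ⊔ Ideal.span {X 0 ^ 2}) (X 3) := b₀.sup_span_sq b₃
  have r₁ : IsRegularModulo J (quadric₁ 0) := by
    refine (b₀.mul b₀).congr ?_
    rwa [← sq]
  have r₂ : IsRegularModulo (J ⊔ Ideal.span {X 0 ^ 2}) (quadric₂ 0) := by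
    refine (c₃.mul c₃).congr (Ideal.mem_sup_left ?_)
    rwa [← sq]
  have r₃ : IsRegularModulo (J ⊔ Ideal.span {X 0 ^ 2} ⊔ Ideal.span {X 3 ^ 2}) (quadric₃ 0 0) := by
    refine c₃.sup_span_sq ?_
    rw [sup_right_comm]
    refine a₀.sup_span_sq ((a₂.mul a₂).congr ?_)
    have e : X 2 * X 2 - quadric₃ (0 : k) 0 =
        (-X 5 * X 1 + -X 2 * (X 4 - X 2)) + -2 * X 3 * X 0 := by
      rw [quadric₃, map_zero]; ring
    rw [e]
    exact add_mem (Ideal.mem_sup_left (Ideal.mem_sup_left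
      (add_mem (J.mul_mem_left _ h1) (J.mul_mem_left _ h42))))
      (Ideal.mul_mem_left _ _ (Ideal.mem_sup_right (Ideal.mem_span_singleton_self _)))
  have h : IsWeaklyRegular (MvPowerSeries (Fin 6) k)
      (L ++ [quadric₁ 0] ++ [quadric₂ 0] ++ [quadric₃ 0 0]) := by
    simp only [isWeaklyRegular_concat_iff, Ideal.ofList_concat, ← hJ]
    rw [← Ideal.sup_span_singleton_congr e₁,
      ← Ideal.sup_span_singleton_congr (Ideal.mem_sup_left e₂)]
    exact ⟨⟨⟨hLr, r₁⟩, r₂⟩, r₃⟩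
  have hmem := quadric_mem_maximalIdeal (0 : k) 0
  refine ((isWeaklyRegular_append_iff _ [quadric₁ 0, quadric₂ 0, quadric₃ 0 0] L).1
    (isWeaklyRegular_of_perm_of_subset_maximalIdeal h ?_ ?_)).1
  · exact List.perm_append_comm (l₁ := L) (l₂ := [quadric₁ 0, quadric₂ 0, quadric₃ 0 0])
  · simp only [hL, List.cons_append, List.nil_append, List.mem_cons, List.not_mem_nil, or_false]
    rintro r (rfl | rfl | rfl | rfl | rfl | rfl) <;>
      first | exact X_mem_maximalIdeal _
            | exact sub_mem (X_mem_maximalIdeal _) (X_mem_maximalIdeal _)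
            | simp only [hmem]

/-- The three quadrics which cut out the closed fibre of the trace map form a regular
sequence. -/
theorem isWeaklyRegular_quadrics (α β : k) :
    IsWeaklyRegular (MvPowerSeries (Fin 6) k) [quadric₁ α, quadric₂ β, quadric₃ α β] := by
  by_cases hα : α = 0
  · by_cases hβ : β = 0
    · rw [hα, hβ]
      exact isWeaklyRegular_quadrics_zero
    · exact isWeaklyRegular_quadrics_of_right_ne_zero α hβ
  · exact isWeaklyRegular_quadrics_of_left_ne_zero hα β

end FramedRing

/-! ### The explicit ring and the trace map -/

theorem map_ringInverse_two {A B : Type*} [CommRing A] [CommRing B] (f : A →+* B)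
    (h : IsUnit (2 : A)) : f (Ring.inverse 2) = Ring.inverse 2 := by
  have h1 : f (Ring.inverse 2) * 2 = 1 := by
    rw [← map_ofNat f 2, ← map_mul, Ring.inverse_mul_cancel _ h, map_one]
  have h2 : IsUnit (2 : B) := by
    rw [← map_ofNat f 2]
    exact h.map f
  rw [← mul_one (f _), ← Ring.mul_inverse_cancel _ h2, ← mul_assoc, h1, one_mul]

namespace FramedDetRing

open FramedRing MvPowerSeries

variable {O : Type u} [CommRing O] {a b c d : O}

theorem mk_det_γ : FramedDetRing.mk a b c d ((1 + tγ) ^ 2 - x₁₁ ^ 2 - x₁₂ a * x₂₁) =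
    FramedDetRing.mk a b c d (C c) :=
  Ideal.Quotient.eq.2 (Ideal.subset_span (Or.inl rfl))

theorem mk_det_δ : FramedDetRing.mk a b c d ((1 + tδ) ^ 2 - y₁₁ ^ 2 - y₁₂ b * y₂₁) =
    FramedDetRing.mk a b c d (C d) :=
  Ideal.Quotient.eq.2 (Ideal.subset_span (Or.inr rfl))

variable [IsLocalRing O]

theorem detIdeal_le_maximalIdeal (hc : residue O c = 1) (hd : residue O d = 1) :
    detIdeal a b c d ≤ maximalIdeal (PS O) := by
  rw [← map_one (residue O), ← sub_eq_zero, ← map_sub, residue_eq_zero_iff] at hc hd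
  rw [detIdeal, Ideal.span_le]
  rintro f (rfl | rfl)
  · rw [SetLike.mem_coe, MvPowerSeries.mem_maximalIdeal_iff, ← neg_mem_iff]
    simpa [tγ, x₁₁, x₁₂, x₂₁] using hc
  · rw [SetLike.mem_coe, MvPowerSeries.mem_maximalIdeal_iff, ← neg_mem_iff]
    simpa [tδ, y₁₁, y₁₂, y₂₁] using hd

theorem isLocalRing (hc : residue O c = 1) (hd : residue O d = 1) :
    IsLocalRing (FramedDetRing a b c d) := by
  have : Nontrivial (FramedDetRing a b c d) :=
    Ideal.Quotient.nontrivial_iff.2 fun h => (maximalIdeal.isMaximal (PS O)).ne_top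
      (top_le_iff.1 (h ▸ detIdeal_le_maximalIdeal hc hd))
  exact IsLocalRing.of_surjective' _ Ideal.Quotient.mk_surjective

theorem map_maximalIdeal [IsLocalRing (FramedDetRing a b c d)] :
    (maximalIdeal (PS O)).map (FramedDetRing.mk a b c d) = maximalIdeal (FramedDetRing a b c d) :=
  IsLocalRing.map_maximalIdeal_of_surjective _ Ideal.Quotient.mk_surjective

theorem mk_mem_maximalIdeal [IsLocalRing (FramedDetRing a b c d)] {f : PS O}
    (hf : constantCoeff f = 0) :
    FramedDetRing.mk a b c d f ∈ maximalIdeal (FramedDetRing a b c d) := by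
  rw [← map_maximalIdeal]
  refine Ideal.mem_map_of_mem _ ?_
  rw [MvPowerSeries.mem_maximalIdeal_iff, hf]
  exact zero_mem _

variable [IsNoetherianRing O] [IsAdicComplete (maximalIdeal O) O]

theorem isAdicComplete [IsLocalRing (FramedDetRing a b c d)] :
    IsAdicComplete (maximalIdeal (FramedDetRing a b c d)) (FramedDetRing a b c d) :=
  IsAdicComplete.quotient_of_isLocalRing _

theorem existsUnique_isTraceMap (hc : residue O c = 1) (hd : residue O d = 1) :
    ∃! Φ, IsTraceMap a b c d Φ := by
  have := isLocalRing (a := a) (b := b) hc hd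
  have := isAdicComplete (a := a) (b := b) (c := c) (d := d)
  let v : Fin 3 → PS O :=
    ![tγ, tδ, (1 + tγ) * (1 + tδ) + Ring.inverse 2 * FramedRing.z a b - 1]
  have hv (i) : FramedDetRing.mk a b c d (v i) ∈ maximalIdeal (FramedDetRing a b c d) := by
    refine mk_mem_maximalIdeal ?_
    fin_cases i <;> simp [v, tγ, tδ, FramedRing.z, x₁₁, x₂₁, y₁₁, y₂₁]
  have hiff (Φ) : IsTraceMap a b c d Φ ↔ ∀ i, Φ (X i) = FramedDetRing.mk a b c d (v i) := by
    simp [IsTraceMap, Fin.forall_fin_succ, v]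
  obtain ⟨Φ, hΦ⟩ := exists_algHom_apply_X (A := O) _ _ hv
  refine ⟨Φ, (hiff Φ).2 hΦ, fun Ψ hΨ => ?_⟩
  replace hΨ := (hiff Ψ).1 hΨ
  exact algHom_ext_of_isHausdorff (maximalIdeal _) (fun i => hΨ i ▸ hv i)
    fun i => (hΨ i).trans (hΦ i).symm

end FramedDetRing

/-! ### Flatness of the trace map -/

theorem IsRegularModulo.of_map {B K : Type*} [CommRing B] [CommRing K] {π : B →+* K}
    (hπ : Function.Surjective π) {J : Ideal B} {f : B}
    (h : IsRegularModulo (J.map π) (π f)) : IsRegularModulo (RingHom.ker π ⊔ J) f := by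
  have e : RingHom.ker π ⊔ J = (J.map π).comap π := by
    rw [Ideal.comap_map_of_surjective _ hπ, ← RingHom.ker_eq_comap_bot, sup_comm]
  rw [e]
  intro b hb
  rw [Ideal.mem_comap, map_mul] at hb
  exact h _ hb

theorem Module.Flat.of_algHom_leftInverse {S R Q : Type*} [CommRing S] [CommRing R] [CommRing Q]
    [Algebra S R] [Algebra S Q] [Module.Flat S Q] (i : R →ₐ[S] Q) (r : Q →ₐ[S] R)
    (h : Function.LeftInverse r i) : Module.Flat S R :=
  Module.Flat.of_retract i.toLinearMap r.toLinearMap (LinearMap.ext h)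

theorem isUnit_two_of_algebra {O : Type*} [CommRing O] (A : Type*) [CommRing A]
    [Algebra O A] (h2 : IsUnit (2 : O)) :
    IsUnit (2 : A) := by
  rw [← map_ofNat (algebraMap O A) 2]
  exact h2.map _

theorem MvPowerSeries.ker_map_residue (σ S : Type*) [CommRing S] [IsLocalRing S]
    [IsNoetherianRing S] :
    RingHom.ker (MvPowerSeries.map (σ := σ) (residue S)) =
      (maximalIdeal S).map (algebraMap S (MvPowerSeries σ S)) := by
  ext f
  rw [← MvPowerSeries.c_eq_algebraMap, MvPowerSeries.mem_map_C_iff (IsNoetherian.noetherian _),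
    RingHom.mem_ker, MvPowerSeries.ext_iff]
  simp [residue_eq_zero_iff]

namespace FramedDetRing

open FramedRing MvPowerSeries RingTheory.Sequence

variable {O : Type u} [CommRing O] [IsLocalRing O]

section Presentation

variable (a b c d : O)

/-- The power series ring `𝒪⟦t₁, t₂, t₃⟧`. -/
abbrev Base (O : Type u) [CommRing O] : Type u := MvPowerSeries (Fin 3) O

/-- The power series ring over `𝒪⟦t₁, t₂, t₃⟧` in `x₁₁, x̂₁₂, x₂₁, y₁₁, ŷ₁₂, y₂₁`. -/
abbrev Total (O : Type u) [CommRing O] : Type u := MvPowerSeries (Fin 6) (Base O)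

/-- The equation for the determinant at `γ`, with `t₁` in place of `t_γ`. -/
noncomputable def relγ : Total O := (1 + C (X 0)) ^ 2 - C (C c) - quadric₁ (C a)

/-- The equation for the determinant at `δ`, with `t₂` in place of `t_δ`. -/
noncomputable def relδ : Total O := (1 + C (X 1)) ^ 2 - C (C d) - quadric₂ (C b)

/-- The equation which says that `t₃` is the third component of the trace map. -/
noncomputable def relγδ : Total O :=
  (1 + C (X 0)) * (1 + C (X 1)) - 1 - C (X 2) + Ring.inverse 2 * quadric₃ (C a) (C b)

/-- The ideal for which the quotient of `Total O` is `FramedDetRing a b c d`. -/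
noncomputable def relIdeal : Ideal (Total O) :=
  ⊥ ⊔ Ideal.span {relγ a c} ⊔ Ideal.span {relδ b d} ⊔ Ideal.span {relγδ a b}

variable {a b c d}

theorem map_residue_relγ (hc : residue O c = 1) :
    MvPowerSeries.map (residue (Base O)) (relγ a c) =
      -quadric₁ (residue (Base O) (C a)) := by
  have hc' : residue (Base O) (C c) = 1 := by
    rw [← map_one (residue _), ← sub_eq_zero, ← map_sub, residue_eq_zero_iff] at hc ⊢
    rw [MvPowerSeries.mem_maximalIdeal_iff]
    simpa using hc
  have hX : residue (Base O) (X 0) = 0 := (residue_eq_zero_iff _).2 (X_mem_maximalIdeal _)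
  simp [relγ, quadric₁, hc', hX]

theorem map_residue_relδ (hd : residue O d = 1) :
    MvPowerSeries.map (residue (Base O)) (relδ b d) =
      -quadric₂ (residue (Base O) (C b)) := by
  have hd' : residue (Base O) (C d) = 1 := by
    rw [← map_one (residue _), ← sub_eq_zero, ← map_sub, residue_eq_zero_iff] at hd ⊢
    rw [MvPowerSeries.mem_maximalIdeal_iff]
    simpa using hd
  have hX : residue (Base O) (X 1) = 0 := (residue_eq_zero_iff _).2 (X_mem_maximalIdeal _)
  simp [relδ, quadric₂, hd', hX]

theorem map_residue_relγδ (h2 : IsUnit (2 : O)) :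
    MvPowerSeries.map (residue (Base O)) (relγδ a b) =
      Ring.inverse 2 * quadric₃ (residue (Base O) (C a)) (residue (Base O) (C b)) := by
  have hX (i) : residue (Base O) (X i) = 0 := (residue_eq_zero_iff _).2 (X_mem_maximalIdeal _)
  rw [relγδ, map_add, map_mul _ (Ring.inverse 2),
    map_ringInverse_two _ (isUnit_two_of_algebra _ h2)]
  have h : MvPowerSeries.map (σ := Fin 6) (residue (Base O)) 2 = 2 := map_ofNat _ 2
  simp [quadric₃, hX, h]

variable [IsNoetherianRing O]

/-- The presentation of `FramedDetRing a b c d` over `𝒪⟦t₁, t₂, t₃⟧` is flat, since the relations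
restrict to a regular sequence on the closed fibre. -/
theorem flat_total_quotient (h2 : IsUnit (2 : O)) (hc : residue O c = 1) (hd : residue O d = 1) :
    Module.Flat (Base O) (Total O ⧸ relIdeal a b c d) := by
  set α := residue (Base O) (C a)
  set β := residue (Base O) (C b)
  set π : Total O →+* MvPowerSeries (Fin 6) (ResidueField (Base O)) :=
    MvPowerSeries.map (residue (Base O))
  have hπ : Function.Surjective π := by
    intro f
    choose g hg using fun d => residue_surjective (R := Base O) (coeff d f)
    refine ⟨fun d => g d, ?_⟩
    ext d
    exact hg d
  have hinv : IsUnit (Ring.inverse 2 : MvPowerSeries (Fin 6) (ResidueField (Base O))) :=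
    (isUnit_two_of_algebra _ h2).ringInverse
  obtain ⟨⟨⟨-, q₁⟩, q₂⟩, q₃⟩ : ((_ ∧ IsRegularModulo ⊥ (quadric₁ α)) ∧
      IsRegularModulo (⊥ ⊔ Ideal.span {quadric₁ α}) (quadric₂ β)) ∧
      IsRegularModulo (⊥ ⊔ Ideal.span {quadric₁ α} ⊔ Ideal.span {quadric₂ β}) (quadric₃ α β) := by
    have h := isWeaklyRegular_quadrics α β
    change IsWeaklyRegular _ ([] ++ [quadric₁ α] ++ [quadric₂ β] ++ [quadric₃ α β]) at h
    simpa only [isWeaklyRegular_concat_iff, Ideal.ofList_concat, Ideal.ofList_nil] using h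
  have e₁ : π (relγ a c) = -1 * quadric₁ α := (map_residue_relγ hc).trans (by ring)
  have e₂ : π (relδ b d) = -1 * quadric₂ β := (map_residue_relδ hd).trans (by ring)
  have e₃ : π (relγδ a b) = Ring.inverse 2 * quadric₃ α β := map_residue_relγδ h2
  have hneg : IsUnit (-1 : MvPowerSeries (Fin 6) (ResidueField (Base O))) := isUnit_one.neg
  have m₁ : (⊥ ⊔ Ideal.span {relγ a c}).map π = ⊥ ⊔ Ideal.span {quadric₁ α} := by
    rw [Ideal.map_sup, Ideal.map_bot, Ideal.map_span, Set.image_singleton, e₁,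
      Ideal.span_singleton_mul_left_unit hneg]
  have m₂ : (⊥ ⊔ Ideal.span {relγ a c} ⊔ Ideal.span {relδ b d}).map π =
      ⊥ ⊔ Ideal.span {quadric₁ α} ⊔ Ideal.span {quadric₂ β} := by
    rw [Ideal.map_sup, m₁, Ideal.map_span, Set.image_singleton, e₂,
      Ideal.span_singleton_mul_left_unit hneg]
  have hker := MvPowerSeries.ker_map_residue (Fin 6) (Base O)
  have hloc : (maximalIdeal (Base O)).map (algebraMap (Base O) (Total O)) ≤
      maximalIdeal (Total O) := by
    rw [Ideal.map_le_iff_le_comap]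
    intro s hs
    rw [Ideal.mem_comap, ← MvPowerSeries.c_eq_algebraMap]
    exact MvPowerSeries.C_mem_maximalIdeal_iff.2 hs
  have F₀ := MvPowerSeries.flatModulo_bot (Fin 6) (Base O)
  have F₁ := F₀.sup_span_singleton (f := relγ a c) hloc (by
    rw [← hker]
    refine IsRegularModulo.of_map hπ ?_
    rw [Ideal.map_bot]
    exact e₁ ▸ (hneg.isRegularModulo _).mul q₁)
  have F₂ := F₁.sup_span_singleton (f := relδ b d) hloc (by
    rw [← hker]
    refine IsRegularModulo.of_map hπ ?_
    rw [m₁]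
    exact e₂ ▸ (hneg.isRegularModulo _).mul q₂)
  have F₃ := F₂.sup_span_singleton (f := relγδ a b) hloc (by
    rw [← hker]
    refine IsRegularModulo.of_map hπ ?_
    rw [m₂]
    exact e₃ ▸ (hinv.isRegularModulo _).mul q₃)
  exact F₃.flat_quotient

end Presentation

theorem relIdeal_le_maximalIdeal {a b c d : O} (hc : residue O c = 1) (hd : residue O d = 1) :
    relIdeal a b c d ≤ maximalIdeal (Total O) := by
  rw [← map_one (residue O), ← sub_eq_zero, ← map_sub, residue_eq_zero_iff] at hc hd
  refine sup_le (sup_le (sup_le bot_le ?_) ?_) ?_ <;>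
    rw [Ideal.span_singleton_le_iff_mem, MvPowerSeries.mem_maximalIdeal_iff,
      MvPowerSeries.mem_maximalIdeal_iff, ← neg_mem_iff]
  · simpa [relγ, quadric₁] using hc
  · simpa [relδ, quadric₂] using hd
  · simp [relγδ, quadric₃]

variable {a b c d : O} [IsNoetherianRing O] [IsAdicComplete (maximalIdeal O) O]

/-- The trace map is flat: `FramedDetRing a b c d` is a retract of its presentation over
`𝒪⟦t₁, t₂, t₃⟧`. -/
theorem flat_of_isTraceMap (h2 : IsUnit (2 : O)) (hc : residue O c = 1) (hd : residue O d = 1)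
    (Φ : MvPowerSeries (Fin 3) O →ₐ[O] FramedDetRing a b c d) (hΦ : IsTraceMap a b c d Φ) :
    Φ.toRingHom.Flat := by
  set R := FramedDetRing a b c d with hR
  set Q := Total O ⧸ relIdeal a b c d with hQ
  set q : Total O →+* Q := Ideal.Quotient.mk (relIdeal a b c d) with hq
  have : IsLocalRing R := isLocalRing hc hd
  have : IsAdicComplete (maximalIdeal R) R := isAdicComplete
  have : Nontrivial Q := Ideal.Quotient.nontrivial_iff.2 fun h =>
    (maximalIdeal.isMaximal (Total O)).ne_top (top_le_iff.1 (h ▸ relIdeal_le_maximalIdeal hc hd))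
  have : IsLocalRing Q := IsLocalRing.of_surjective' q Ideal.Quotient.mk_surjective
  have : IsAdicComplete (maximalIdeal Q) Q := IsAdicComplete.quotient_of_isLocalRing _
  have hflat : Module.Flat (Base O) Q := flat_total_quotient h2 hc hd
  have hqm {f : Total O} (hf : f ∈ maximalIdeal (Total O)) : q f ∈ maximalIdeal Q := by
    rw [← IsLocalRing.map_maximalIdeal_of_surjective q Ideal.Quotient.mk_surjective]
    exact Ideal.mem_map_of_mem _ hf
  -- the homomorphism from the explicit ring to its presentation
  let v : Fin 8 → Total O := ![X 0, X 1, X 2, C (X 0), X 3, X 4, X 5, C (X 1)]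
  have hv (i) : q (v i) ∈ maximalIdeal Q := by
    refine hqm ?_
    rw [MvPowerSeries.mem_maximalIdeal_iff, MvPowerSeries.mem_maximalIdeal_iff]
    fin_cases i <;> simp [v]
  obtain ⟨χ, hχ⟩ := exists_algHom_apply_X (A := O) (maximalIdeal Q) (fun i => q (v i)) hv
  have hχC (s : O) : χ (C s) = q (C (C s)) := by
    have e : algebraMap O (Total O) s = C (C s) := by
      rw [MvPowerSeries.algebraMap_apply, MvPowerSeries.c_eq_algebraMap (R := O)]
    rw [← e]
    exact χ.commutes s
  have hχ0 : χ (X 0) = q (X 0) := hχ 0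
  have hχ1 : χ (X 1) = q (X 1) := hχ 1
  have hχ2 : χ (X 2) = q (X 2) := hχ 2
  have hχ3 : χ (X 3) = q (C (X 0)) := hχ 3
  have hχ4 : χ (X 4) = q (X 3) := hχ 4
  have hχ5 : χ (X 5) = q (X 4) := hχ 5
  have hχ6 : χ (X 6) = q (X 5) := hχ 6
  have hχ7 : χ (X 7) = q (C (X 1)) := hχ 7
  have hqγ : q (relγ a c) = 0 := Ideal.Quotient.eq_zero_iff_mem.2
    (Ideal.mem_sup_left (Ideal.mem_sup_left
      (Ideal.mem_sup_right (Ideal.mem_span_singleton_self _))))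
  have hqδ : q (relδ b d) = 0 := Ideal.Quotient.eq_zero_iff_mem.2
    (Ideal.mem_sup_left (Ideal.mem_sup_right (Ideal.mem_span_singleton_self _)))
  have hqγδ : q (relγδ a b) = 0 := Ideal.Quotient.eq_zero_iff_mem.2
    (Ideal.mem_sup_right (Ideal.mem_span_singleton_self _))
  have hχker : ∀ f ∈ detIdeal a b c d, χ f = 0 := by
    change detIdeal a b c d ≤ RingHom.ker χ
    rw [detIdeal, Ideal.span_le]
    rintro f (rfl | rfl)
    · rw [SetLike.mem_coe, RingHom.mem_ker, ← hqγ]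
      simp only [tγ, x₁₁, x₁₂, x₂₁, relγ, quadric₁, map_sub, map_add, map_mul, map_pow, map_one,
        hχC, hχ0, hχ1, hχ2, hχ3]
      ring
    · rw [SetLike.mem_coe, RingHom.mem_ker, ← hqδ]
      simp only [tδ, y₁₁, y₁₂, y₂₁, relδ, quadric₂, map_sub, map_add, map_mul, map_pow, map_one,
        hχC, hχ4, hχ5, hχ6, hχ7]
      ring
  let χ' : R →ₐ[O] Q := Ideal.Quotient.liftₐ _ χ hχker
  have hχ' (f : PS O) : χ' (FramedDetRing.mk a b c d f) = χ f := rfl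
  have hχΦ : χ'.comp Φ = IsScalarTower.toAlgHom O (Base O) Q := by
    have hX (i) : χ'.comp Φ (X i) = IsScalarTower.toAlgHom O (Base O) Q (X i) := by
      change χ' (Φ (X i)) = q (C (X i))
      obtain ⟨h0, h1, h2'⟩ := hΦ
      have hi : i = 0 ∨ i = 1 ∨ i = 2 := by omega
      rcases hi with rfl | rfl | rfl
      · rw [h0, hχ', tγ, hχ3]
      · rw [h1, hχ', tδ, hχ7]
      · rw [h2', hχ', ← sub_eq_zero, ← hqγδ]
        have e1 := map_ringInverse_two (χ : PS O →+* Q) (isUnit_two_of_algebra (PS O) h2)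
        have e2 := map_ringInverse_two q (isUnit_two_of_algebra (Total O) h2)
        rw [RingHom.coe_coe] at e1
        simp only [tγ, tδ, FramedRing.z, x₁₁, x₁₂, x₂₁, y₁₁, y₁₂, y₂₁, relγδ, quadric₃, map_sub,
          map_add, map_mul, map_one, map_ofNat, e1, e2, hχC, hχ0, hχ1, hχ2, hχ3, hχ4, hχ5, hχ6,
          hχ7]
        ring
    refine algHom_ext_of_isHausdorff (maximalIdeal Q) (fun i => ?_) hX
    rw [hX i]
    refine hqm ?_
    rw [← MvPowerSeries.c_eq_algebraMap, MvPowerSeries.C_mem_maximalIdeal_iff]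
    exact X_mem_maximalIdeal _
  -- the homomorphism in the other direction
  let : Algebra (Base O) R := Φ.toRingHom.toAlgebra
  have hΦalg (s : Base O) : algebraMap (Base O) R s = Φ s := rfl
  have : IsScalarTower O (Base O) R := IsScalarTower.of_algebraMap_eq fun s => (Φ.commutes s).symm
  let w : Fin 6 → PS O := ![X 0, X 1, X 2, X 4, X 5, X 6]
  obtain ⟨θ, hθ⟩ := exists_algHom_apply_X (A := Base O) (maximalIdeal R)
    (fun i => FramedDetRing.mk a b c d (w i)) (fun i => mk_mem_maximalIdeal (by
      fin_cases i <;> simp [w]))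
  set r := FramedDetRing.mk a b c d with hr
  have hθC (s : Base O) : θ (C s) = Φ s := θ.commutes s
  have hΦC (s : O) : Φ (C s) = r (C s) := Φ.commutes s
  have hθ0 : θ (X 0) = r (X 0) := hθ 0
  have hθ1 : θ (X 1) = r (X 1) := hθ 1
  have hθ2 : θ (X 2) = r (X 2) := hθ 2
  have hθ3 : θ (X 3) = r (X 4) := hθ 3
  have hθ4 : θ (X 4) = r (X 5) := hθ 4
  have hθ5 : θ (X 5) = r (X 6) := hθ 5
  obtain ⟨hΦ0, hΦ1, hΦ2⟩ := hΦ
  rw [← hr] at hΦ0 hΦ1 hΦ2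
  have hθker : ∀ f ∈ relIdeal a b c d, θ f = 0 := by
    have hγ := mk_det_γ (a := a) (b := b) (c := c) (d := d)
    have hδ := mk_det_δ (a := a) (b := b) (c := c) (d := d)
    rw [← hr] at hγ hδ
    change relIdeal a b c d ≤ RingHom.ker θ
    refine sup_le (sup_le (sup_le bot_le ?_) ?_) ?_ <;>
      rw [Ideal.span_singleton_le_iff_mem, RingHom.mem_ker]
    · rw [← sub_eq_zero.2 hγ]
      simp only [tγ, x₁₁, x₁₂, x₂₁, relγ, quadric₁, map_sub, map_add, map_mul, map_pow, map_one,
        hθC, hΦC, hθ0, hθ1, hθ2, hΦ0]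
      ring
    · rw [← sub_eq_zero.2 hδ]
      simp only [tδ, y₁₁, y₁₂, y₂₁, relδ, quadric₂, map_sub, map_add, map_mul, map_pow, map_one,
        hθC, hΦC, hθ3, hθ4, hθ5, hΦ1]
      ring
    · have e1 := map_ringInverse_two (θ : Total O →+* R) (isUnit_two_of_algebra (Total O) h2)
      have e2 := map_ringInverse_two r (isUnit_two_of_algebra (PS O) h2)
      rw [RingHom.coe_coe] at e1
      simp only [relγδ, quadric₃, map_sub, map_add, map_mul, map_one, map_ofNat, e1, hθC, hΦC, hθ0,
        hθ1, hθ2, hθ3, hθ4, hθ5, hΦ0, hΦ1, hΦ2, tγ, tδ, FramedRing.z, x₁₁, x₁₂, x₂₁, y₁₁, y₁₂, y₂₁,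
        e2]
      ring
  let θ' : Q →ₐ[Base O] R := Ideal.Quotient.liftₐ _ θ hθker
  have hθ' (f : Total O) : θ' (q f) = θ f := rfl
  have hretr : (θ'.restrictScalars O).comp χ = Ideal.Quotient.mkₐ O (detIdeal a b c d) := by
    have hX (i) : (θ'.restrictScalars O).comp χ (X i) = r (X i) := by
      change θ' (χ (X i)) = r (X i)
      rw [hχ, hθ']
      fin_cases i
      exacts [hθ0, hθ1, hθ2, (hθC _).trans hΦ0, hθ3, hθ4, hθ5, (hθC _).trans hΦ1]
    refine algHom_ext_of_isHausdorff (maximalIdeal R) (fun i => ?_) hX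
    rw [hX i]
    exact mk_mem_maximalIdeal (by simp)
  have hcomm (s : Base O) : χ' (algebraMap (Base O) R s) = algebraMap (Base O) Q s :=
    DFunLike.congr_fun hχΦ s
  let χ'' : R →ₐ[Base O] Q := { χ'.toRingHom with commutes' := hcomm }
  refine Module.Flat.of_algHom_leftInverse χ'' θ' fun x => ?_
  obtain ⟨f, rfl⟩ := Ideal.Quotient.mk_surjective x
  exact DFunLike.congr_fun hretr f

end FramedDetRing

universe w

/-! ### Homomorphisms to finite `p`-groups -/

namespace IsFreeProPBasis

variable {p : ℕ} {G : Type v} [Group G] [TopologicalSpace G] [IsTopologicalGroup G] {γ δ : G}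

theorem continuous_iff_isOpen_ker {H : Type*} [Group H] [TopologicalSpace H] [DiscreteTopology H]
    {f : G →* H} : Continuous f ↔ IsOpen (f.ker : Set G) := by
  refine ⟨fun hf => (isOpen_discrete ({1} : Set H)).preimage hf, fun hf => ?_⟩
  apply continuous_of_continuousAt_one
  rw [ContinuousAt, nhds_discrete H, map_one, Filter.tendsto_pure]
  exact hf.mem_nhds (map_one f)

/-- The universal property of a basis, for finite `p`-groups in an arbitrary universe. -/
theorem existsUnique_monoidHom (h : IsFreeProPBasis p γ δ) {H : Type w} [Group H] [Finite H]
    (hH : IsPGroup p H) (a b : H) :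
    ∃! f : G →* H, IsOpen (f.ker : Set G) ∧ f γ = a ∧ f δ = b := by
  have : Small.{0} H := inferInstance
  let e : Shrink.{0} H ≃* H := Shrink.mulEquiv
  have : Finite (Shrink.{0} H) := Finite.of_equiv H e.symm
  let : TopologicalSpace (Shrink.{0} H) := ⊥
  have : DiscreteTopology (Shrink.{0} H) := ⟨rfl⟩
  obtain ⟨f, ⟨hf, hfγ, hfδ⟩, huniq⟩ := h (Shrink.{0} H) (hH.of_equiv e.symm) (e.symm a) (e.symm b)
  refine ⟨e.toMonoidHom.comp f, ⟨?_, by simp [hfγ], by simp [hfδ]⟩, ?_⟩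
  · have : (e.toMonoidHom.comp f).ker = f.ker := by
      ext g
      simp [MonoidHom.mem_ker]
    rw [this]
    exact continuous_iff_isOpen_ker.1 hf
  · rintro f' ⟨hf', hγ', hδ'⟩
    have e1 : e.symm.toMonoidHom.comp f' = f := by
      refine huniq _ ⟨continuous_iff_isOpen_ker.2 ?_, by simp [hγ'], by simp [hδ']⟩
      have : (e.symm.toMonoidHom.comp f').ker = f'.ker := by
        ext g
        simp [MonoidHom.mem_ker]
      rwa [this]
    rw [← e1]
    ext g
    simp

/-- Values in a finite `p`-subgroup `P` of `H` can be prescribed at the basis. -/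
theorem exists_monoidHom (h : IsFreeProPBasis p γ δ) {H : Type w} [Group H] (P : Subgroup H)
    [Finite P] (hP : IsPGroup p P) {a b : H} (ha : a ∈ P) (hb : b ∈ P) :
    ∃ f : G →* H, IsOpen (f.ker : Set G) ∧ (∀ g, f g ∈ P) ∧ f γ = a ∧ f δ = b := by
  obtain ⟨f, ⟨hf, hγ, hδ⟩, -⟩ := h.existsUnique_monoidHom hP ⟨a, ha⟩ ⟨b, hb⟩
  refine ⟨P.subtype.comp f, ?_, fun g => (f g).2, by simp [hγ], by simp [hδ]⟩
  have : (P.subtype.comp f).ker = f.ker := by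
    ext g
    simp [MonoidHom.mem_ker]
  rwa [this]

theorem monoidHom_ext (h : IsFreeProPBasis p γ δ) {H : Type w} [Group H] (P : Subgroup H)
    [Finite P] (hP : IsPGroup p P) {f f' : G →* H} (hf : IsOpen (f.ker : Set G))
    (hf' : IsOpen (f'.ker : Set G)) (hfP : ∀ g, f g ∈ P) (hfP' : ∀ g, f' g ∈ P)
    (hγ : f γ = f' γ) (hδ : f δ = f' δ) : f = f' := by
  have key := (h.existsUnique_monoidHom hP ⟨f γ, hfP γ⟩ ⟨f δ, hfP δ⟩).unique
    (y₁ := f.codRestrict P hfP) (y₂ := f'.codRestrict P hfP')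
    ⟨by rwa [MonoidHom.ker_codRestrict], rfl, rfl⟩
    ⟨by rwa [MonoidHom.ker_codRestrict], Subtype.ext hγ.symm, Subtype.ext hδ.symm⟩
  ext1 g
  exact congrArg Subtype.val (DFunLike.congr_fun key g)

end IsFreeProPBasis

/-! ### Congruence subgroups are `p`-groups -/

theorem Matrix.isNilpotent_of_apply_mem {A : Type u} [CommRing A] {n : Type*}
    [Fintype n] [DecidableEq n] {I : Ideal A}
    (hI : IsNilpotent I) {N : Matrix n n A} (hN : ∀ i j, N i j ∈ I) : IsNilpotent N := by
  obtain ⟨b, hb⟩ := hI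
  have key (b : ℕ) : ∀ i j, (N ^ b) i j ∈ I ^ b := by
    induction b with
    | zero => simp
    | succ b ih =>
      intro i j
      rw [pow_succ, pow_succ, Matrix.mul_apply]
      exact Ideal.sum_mem _ fun k _ => Ideal.mul_mem_mul (ih i k) (hN k j)
  refine ⟨b, ?_⟩
  ext i j
  have := key b i j
  rwa [hb] at this

theorem isNilpotent_natCast_of_mem {p : ℕ} {A : Type u} [CommRing A] [IsLocalRing A]
    {E : Type*} [Ring E] [Algebra A E]
    (hm : IsNilpotent (maximalIdeal A)) (hpA : (p : A) ∈ maximalIdeal A) :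
    IsNilpotent (p : E) := by
  obtain ⟨n, hn⟩ := hm
  refine ⟨n, ?_⟩
  have := Ideal.pow_mem_pow hpA n
  rw [hn, Ideal.zero_eq_bot, Ideal.mem_bot] at this
  rw [← map_natCast (algebraMap A E), ← map_pow, this, map_zero]

section PGroups

variable {p : ℕ} [hp : Fact p.Prime]

theorem Ideal.one_add_pow_pow_sub_one_mem {R : Type*} [CommRing R] {I : Ideal R}
    (hpI : (p : R) ∈ I) {x : R} (hx : x ∈ I) (j : ℕ) : (1 + x) ^ p ^ j - 1 ∈ I ^ (j + 1) := by
  induction j with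
  | zero => simpa using hx
  | succ j ih =>
    set y := (1 + x) ^ p ^ j - 1
    obtain ⟨r, hr⟩ := exists_add_pow_prime_eq hp.out y 1
    have e : (1 + x) ^ p ^ (j + 1) - 1 = y ^ p + p * y * r := by
      have : (1 + x) ^ p ^ j = y + 1 := by ring
      rw [pow_succ, pow_mul, this, hr]
      ring
    rw [e]
    refine add_mem ?_ (Ideal.mul_mem_right _ _ ?_)
    · have h2 := hp.out.two_le
      have := Ideal.pow_mem_pow ih p
      rw [← pow_mul] at this
      exact Ideal.pow_le_pow_right (by nlinarith) this
    · rw [pow_succ']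
      exact Ideal.mul_mem_mul hpI ih

/-- In a ring where `p` is nilpotent, unipotent elements have `p`-power order. The ring need not be
commutative: the computation takes place in the image of `ℤ[X]`. -/
theorem exists_one_add_pow_pow_eq_one {E : Type*} [Ring E] (hpE : IsNilpotent (p : E)) {x : E}
    (hx : IsNilpotent x) : ∃ j, (1 + x) ^ p ^ j = 1 := by
  obtain ⟨a, ha⟩ := hpE
  obtain ⟨b, hb⟩ := hx
  refine ⟨a + b, ?_⟩
  set I : Ideal (Polynomial ℤ) := Ideal.span {(p : Polynomial ℤ)} ⊔ Ideal.span {Polynomial.X}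
  have h1 := Ideal.one_add_pow_pow_sub_one_mem (p := p) (I := I) (x := Polynomial.X)
    (Ideal.mem_sup_left (Ideal.mem_span_singleton_self _))
    (Ideal.mem_sup_right (Ideal.mem_span_singleton_self _)) (a + b)
  have h2 := Ideal.sup_pow_add_le_pow_sup_pow (Ideal.pow_le_pow_right (Nat.le_succ (a + b)) h1)
  rw [Ideal.span_singleton_pow, Ideal.span_singleton_pow, Submodule.mem_sup] at h2
  obtain ⟨u, hu, v, hv, e⟩ := h2
  obtain ⟨u, rfl⟩ := Ideal.mem_span_singleton.1 hu
  obtain ⟨v, rfl⟩ := Ideal.mem_span_singleton.1 hv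
  have := congrArg (Polynomial.aeval x) e
  simp only [map_add, map_mul, map_pow, map_natCast, ha, Polynomial.aeval_X, hb, zero_mul, map_sub,
    map_one, add_zero] at this
  exact (sub_eq_zero.1 this.symm)

variable {A : Type u} [CommRing A] [IsLocalRing A]

theorem isPGroup_ker_map_residue (hm : IsNilpotent (maximalIdeal A))
    (hpA : (p : A) ∈ maximalIdeal A) :
    IsPGroup p (Matrix.GeneralLinearGroup.map (n := Fin 2) (residue A)).ker := by
  rintro ⟨M, hM⟩
  have hN : IsNilpotent (M.val - 1) := by
    refine Matrix.isNilpotent_of_apply_mem hm fun i j => ?_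
    rw [← residue_eq_zero_iff, Matrix.sub_apply, map_sub, sub_eq_zero,
      ← Matrix.GeneralLinearGroup.map_apply, MonoidHom.mem_ker.1 hM]
    simp [Matrix.one_apply, apply_ite]
  obtain ⟨j, hj⟩ := exists_one_add_pow_pow_eq_one (p := p)
    (isNilpotent_natCast_of_mem (E := Matrix (Fin 2) (Fin 2) A) hm hpA) hN
  refine ⟨j, Subtype.ext (Units.ext ?_)⟩
  simpa using hj

theorem isPGroup_ker_unitsMap_residue (hm : IsNilpotent (maximalIdeal A))
    (hpA : (p : A) ∈ maximalIdeal A) :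
    IsPGroup p (Units.map (residue A : A →* ResidueField A)).ker := by
  rintro ⟨x, hx⟩
  have hx' : (x : A) - 1 ∈ maximalIdeal A := by
    rw [← residue_eq_zero_iff, map_sub, map_one, sub_eq_zero]
    exact congrArg Units.val (MonoidHom.mem_ker.1 hx)
  have hN : IsNilpotent ((x : A) - 1) := by
    obtain ⟨n, hn⟩ := hm
    refine ⟨n, ?_⟩
    have := Ideal.pow_mem_pow hx' n
    rwa [hn] at this
  obtain ⟨j, hj⟩ := exists_one_add_pow_pow_eq_one (p := p)
    (isNilpotent_natCast_of_mem (E := A) hm hpA) hN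
  refine ⟨j, Subtype.ext (Units.ext ?_)⟩
  simpa using hj

variable (A) in
/-- The subgroup of `GL₂(A)` of matrices which are upper unipotent modulo the maximal ideal. -/
noncomputable def residuallyUnipotent : Subgroup (GL (Fin 2) A) :=
  (Matrix.GeneralLinearGroup.upperRightHom (R := ResidueField A)).toMonoidHom.range.comap
    (Matrix.GeneralLinearGroup.map (residue A))

theorem mem_residuallyUnipotent_iff {M : GL (Fin 2) A} :
    M ∈ residuallyUnipotent A ↔
      residue A (M 0 0) = 1 ∧ residue A (M 1 0) = 0 ∧ residue A (M 1 1) = 1 := by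
  rw [residuallyUnipotent, Subgroup.mem_comap, MonoidHom.mem_range]
  constructor
  · rintro ⟨x, hx⟩
    have h (i j) : residue A (M i j) =
        (Matrix.GeneralLinearGroup.upperRightHom x.toAdd) i j := by
      rw [← Matrix.GeneralLinearGroup.map_apply, ← hx]
      rfl
    simp [h]
  · rintro ⟨h00, h10, h11⟩
    refine ⟨Multiplicative.ofAdd (residue A (M 0 1)), ?_⟩
    ext i j
    rw [Matrix.GeneralLinearGroup.map_apply]
    fin_cases i <;> fin_cases j <;> simp [h00, h10, h11]

theorem isPGroup_residuallyUnipotent (hm : IsNilpotent (maximalIdeal A))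
    (hpA : (p : A) ∈ maximalIdeal A) : IsPGroup p (residuallyUnipotent A) := by
  refine IsPGroup.comap_of_ker_isPGroup ?_ _ (isPGroup_ker_map_residue hm hpA)
  have h : IsPGroup p (Multiplicative (ResidueField A)) := fun x => ⟨1, by
    have hp0 : (p : ResidueField A) = 0 := by
      rw [← map_natCast (residue A), residue_eq_zero_iff]
      exact hpA
    rw [pow_one]
    change p • x.toAdd = 0
    rw [nsmul_eq_mul, hp0, zero_mul]⟩
  exact h.of_surjective _ (MonoidHom.rangeRestrict_surjective _)

end PGroups

/-! ### Residually unipotent representations over complete local rings -/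

section QuotientPow

variable (R : Type u) [CommRing R] [IsLocalRing R]

instance IsLocalRing.quotient_maximalIdeal_pow_succ (n : ℕ) :
    IsLocalRing (R ⧸ maximalIdeal R ^ (n + 1)) := by
  have : Nontrivial (R ⧸ maximalIdeal R ^ (n + 1)) :=
    Ideal.Quotient.nontrivial_iff.2 fun h => (maximalIdeal.isMaximal R).ne_top
      (top_le_iff.1 (h ▸ Ideal.pow_le_self n.succ_ne_zero))
  exact IsLocalRing.of_surjective' (Ideal.Quotient.mk _) Ideal.Quotient.mk_surjective

theorem IsLocalRing.finite_quotient_maximalIdeal_pow [IsNoetherianRing R]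
    [Finite (ResidueField R)] (n : ℕ) : Finite (R ⧸ maximalIdeal R ^ n) := by
  have : Finite (R ⧸ maximalIdeal R) := inferInstanceAs (Finite (ResidueField R))
  exact Ideal.finite_quotient_pow (IsNoetherian.noetherian _) n

variable {R}

theorem IsLocalRing.isNilpotent_maximalIdeal_quotient (n : ℕ) :
    IsNilpotent (maximalIdeal (R ⧸ maximalIdeal R ^ (n + 1))) := by
  refine ⟨n + 1, ?_⟩
  rw [← IsLocalRing.map_maximalIdeal_of_surjective (Ideal.Quotient.mk (maximalIdeal R ^ (n + 1)))
    Ideal.Quotient.mk_surjective, ← Ideal.map_pow, Ideal.map_quotient_self, Ideal.zero_eq_bot]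

theorem IsLocalRing.mem_maximalIdeal_of_surjective {S : Type*} [CommRing S] [IsLocalRing S]
    {f : R →+* S} (hf : Function.Surjective f) {x : R} (hx : x ∈ maximalIdeal R) :
    f x ∈ maximalIdeal S := by
  rw [← IsLocalRing.map_maximalIdeal_of_surjective f hf]
  exact Ideal.mem_map_of_mem f hx

theorem IsLocalRing.eq_of_forall_mk_eq [IsHausdorff (maximalIdeal R) R] {x y : R}
    (h : ∀ n, Ideal.Quotient.mk (maximalIdeal R ^ (n + 1)) x = Ideal.Quotient.mk _ y) : x = y := by
  rw [← sub_eq_zero]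
  refine IsHausdorff.haus ‹_› _ fun n => ?_
  rw [SModEq.zero, smul_eq_mul, Ideal.mul_top]
  exact Ideal.pow_le_pow_right n.le_succ (Ideal.Quotient.eq.1 (h n))

theorem mem_residuallyUnipotent_iff_mem {M : GL (Fin 2) R} :
    M ∈ residuallyUnipotent R ↔
      M 0 0 - 1 ∈ maximalIdeal R ∧ M 1 0 ∈ maximalIdeal R ∧ M 1 1 - 1 ∈ maximalIdeal R := by
  simp only [mem_residuallyUnipotent_iff, ← residue_eq_zero_iff, map_sub, map_one, sub_eq_zero]

theorem map_mem_residuallyUnipotent {S : Type*} [CommRing S] [IsLocalRing S]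
    {f : R →+* S} (hf : ∀ x ∈ maximalIdeal R, f x ∈ maximalIdeal S) {M : GL (Fin 2) R}
    (hM : M ∈ residuallyUnipotent R) :
    Matrix.GeneralLinearGroup.map f M ∈ residuallyUnipotent S := by
  rw [mem_residuallyUnipotent_iff_mem] at hM ⊢
  simp only [Matrix.GeneralLinearGroup.map_apply]
  rw [← map_one f, ← map_sub, ← map_sub]
  exact ⟨hf _ hM.1, hf _ hM.2.1, hf _ hM.2.2⟩

end QuotientPow

section Reps

variable {G : Type v} [Group G] [TopologicalSpace G] {R : Type u} [CommRing R] [IsLocalRing R]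

theorem IsAdicContinuousRep.isOpen_ker {ρ : G →* GL (Fin 2) R} (hρ : IsAdicContinuousRep ρ)
    (n : ℕ) : IsOpen (((Matrix.GeneralLinearGroup.map
      (Ideal.Quotient.mk (maximalIdeal R ^ n))).comp ρ).ker : Set G) := by
  convert hρ n using 1
  ext g
  simp only [SetLike.mem_coe, MonoidHom.mem_ker, MonoidHom.comp_apply, Set.mem_ofPred_eq,
    ← Ideal.Quotient.eq]
  rw [Matrix.GeneralLinearGroup.ext_iff]
  simp [Matrix.one_apply, apply_ite]

theorem isAdicContinuousChar_iff_isOpen_ker {χ : G →* Rˣ} :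
    IsAdicContinuousChar χ ↔ ∀ n, IsOpen (((Units.map
      (Ideal.Quotient.mk (maximalIdeal R ^ n) : R →* R ⧸ maximalIdeal R ^ n)).comp χ).ker :
        Set G) := by
  refine forall_congr' fun n => ?_
  have : {g : G | (χ g : R) - 1 ∈ maximalIdeal R ^ n} = ((Units.map
      (Ideal.Quotient.mk (maximalIdeal R ^ n) : R →* R ⧸ maximalIdeal R ^ n)).comp χ).ker := by
    ext g
    simp [MonoidHom.mem_ker, ← Ideal.Quotient.eq, Units.ext_iff]
  rw [this]

theorem IsAdicContinuousChar.isOpen_ker {χ : G →* Rˣ} (hχ : IsAdicContinuousChar χ)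
    (n : ℕ) : IsOpen (((Units.map
      (Ideal.Quotient.mk (maximalIdeal R ^ n) : R →* R ⧸ maximalIdeal R ^ n)).comp χ).ker :
        Set G) :=
  isAdicContinuousChar_iff_isOpen_ker.1 hχ n

theorem isAdicContinuousRep_of_isOpen_ker {ρ : G →* GL (Fin 2) R}
    (h : ∀ n : ℕ, IsOpen (((Matrix.GeneralLinearGroup.map
      (Ideal.Quotient.mk (maximalIdeal R ^ (n + 1)))).comp ρ).ker : Set G)) :
    IsAdicContinuousRep ρ := by
  rintro (_ | n)
  · simp
  · convert h n using 1
    ext g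
    simp only [SetLike.mem_coe, MonoidHom.mem_ker, MonoidHom.comp_apply, Set.mem_ofPred_eq,
      ← Ideal.Quotient.eq]
    rw [Matrix.GeneralLinearGroup.ext_iff]
    simp [Matrix.one_apply, apply_ite]

variable [IsTopologicalGroup G] [IsNoetherianRing R]
  [Finite (ResidueField R)] {p : ℕ} [Fact p.Prime] {γ δ : G}

namespace IsFreeProPBasis

/-- A residually unipotent representation is determined by its values at `γ` and `δ`. -/
theorem rep_ext [IsHausdorff (maximalIdeal R) R] (h : IsFreeProPBasis p γ δ)
    (hpR : (p : R) ∈ maximalIdeal R)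
    {ρ ρ' : G →* GL (Fin 2) R} (hρ : IsAdicContinuousRep ρ) (hρ' : IsAdicContinuousRep ρ')
    (hu : ∀ g, ρ g ∈ residuallyUnipotent R) (hu' : ∀ g, ρ' g ∈ residuallyUnipotent R)
    (hγ : ρ γ = ρ' γ) (hδ : ρ δ = ρ' δ) : ρ = ρ' := by
  ext g i j
  refine IsLocalRing.eq_of_forall_mk_eq fun n => ?_
  set π := Ideal.Quotient.mk (maximalIdeal R ^ (n + 1)) with hπ
  have hloc (x : R) (hx : x ∈ maximalIdeal R) : π x ∈ maximalIdeal _ :=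
    IsLocalRing.mem_maximalIdeal_of_surjective Ideal.Quotient.mk_surjective hx
  have := IsLocalRing.finite_quotient_maximalIdeal_pow R (n + 1)
  have hp := hloc _ hpR
  rw [map_natCast] at hp
  have e := h.monoidHom_ext (residuallyUnipotent (R ⧸ maximalIdeal R ^ (n + 1)))
    (isPGroup_residuallyUnipotent (IsLocalRing.isNilpotent_maximalIdeal_quotient n) hp)
    (hρ.isOpen_ker (n + 1)) (hρ'.isOpen_ker (n + 1))
    (fun g => map_mem_residuallyUnipotent hloc (hu g))
    (fun g => map_mem_residuallyUnipotent hloc (hu' g))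
    (congrArg (Matrix.GeneralLinearGroup.map π) hγ) (congrArg (Matrix.GeneralLinearGroup.map π) hδ)
  have := congrArg (fun M : GL (Fin 2) _ => M i j) (DFunLike.congr_fun e g)
  simpa using this

/-- A residually trivial character is determined by its values at `γ` and `δ`. -/
theorem char_ext [IsHausdorff (maximalIdeal R) R] (h : IsFreeProPBasis p γ δ)
    (hpR : (p : R) ∈ maximalIdeal R)
    {χ χ' : G →* Rˣ} (hχ : IsAdicContinuousChar χ) (hχ' : IsAdicContinuousChar χ')
    (hu : ∀ g, (χ g : R) - 1 ∈ maximalIdeal R) (hu' : ∀ g, (χ' g : R) - 1 ∈ maximalIdeal R)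
    (hγ : χ γ = χ' γ) (hδ : χ δ = χ' δ) : χ = χ' := by
  ext g
  refine IsLocalRing.eq_of_forall_mk_eq fun n => ?_
  set π := Ideal.Quotient.mk (maximalIdeal R ^ (n + 1)) with hπ
  have hloc (x : R) (hx : x ∈ maximalIdeal R) : π x ∈ maximalIdeal _ :=
    IsLocalRing.mem_maximalIdeal_of_surjective Ideal.Quotient.mk_surjective hx
  have := IsLocalRing.finite_quotient_maximalIdeal_pow R (n + 1)
  have hp := hloc _ hpR
  rw [map_natCast] at hp
  have hker (x : Rˣ) (hx : (x : R) - 1 ∈ maximalIdeal R) :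
      Units.map (π : R →* R ⧸ maximalIdeal R ^ (n + 1)) x ∈
        (Units.map (residue (R ⧸ maximalIdeal R ^ (n + 1)) :
        _ →* ResidueField (R ⧸ maximalIdeal R ^ (n + 1)))).ker := by
    have := hloc _ hx
    rw [← residue_eq_zero_iff, map_sub, map_sub, map_one, map_one, sub_eq_zero] at this
    exact MonoidHom.mem_ker.2 (Units.ext this)
  have e := h.monoidHom_ext _
    (isPGroup_ker_unitsMap_residue (IsLocalRing.isNilpotent_maximalIdeal_quotient n) hp)
    (hχ.isOpen_ker (n + 1)) (hχ'.isOpen_ker (n + 1))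
    (fun g => hker _ (hu g)) (fun g => hker _ (hu' g))
    (congrArg (Units.map (π : R →* R ⧸ maximalIdeal R ^ (n + 1))) hγ)
    (congrArg (Units.map (π : R →* R ⧸ maximalIdeal R ^ (n + 1))) hδ)
  exact congrArg Units.val (DFunLike.congr_fun e g)

/-- Over a complete local noetherian ring with finite residue field of characteristic `p`, the
values at `γ` and `δ` of a residually unipotent representation can be prescribed: the
representation is the limit of its reductions modulo the powers of the maximal ideal, which take
values in finite `p`-groups. -/
theorem exists_rep [IsAdicComplete (maximalIdeal R) R] (h : IsFreeProPBasis p γ δ)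
    (hpR : (p : R) ∈ maximalIdeal R) {M N : GL (Fin 2) R} (hM : M ∈ residuallyUnipotent R)
    (hN : N ∈ residuallyUnipotent R) :
    ∃ ρ : G →* GL (Fin 2) R, IsAdicContinuousRep ρ ∧ (∀ g, ρ g ∈ residuallyUnipotent R) ∧
      ρ γ = M ∧ ρ δ = N := by
  let π (n : ℕ) : R →+* R ⧸ maximalIdeal R ^ (n + 1) := Ideal.Quotient.mk _
  have hπ (n : ℕ) : Function.Surjective (π n) := Ideal.Quotient.mk_surjective
  have hloc (n : ℕ) (x : R) (hx : x ∈ maximalIdeal R) : π n x ∈ maximalIdeal _ :=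
    IsLocalRing.mem_maximalIdeal_of_surjective (hπ n) hx
  have hfin (n : ℕ) := IsLocalRing.finite_quotient_maximalIdeal_pow R (n + 1)
  have hP (n : ℕ) : IsPGroup p (residuallyUnipotent (R ⧸ maximalIdeal R ^ (n + 1))) :=
    isPGroup_residuallyUnipotent (IsLocalRing.isNilpotent_maximalIdeal_quotient n)
      (by simpa using hloc n _ hpR)
  choose r hr_open hr_mem hrγ hrδ using fun n =>
    h.exists_monoidHom _ (hP n) (map_mem_residuallyUnipotent (hloc n) hM)
      (map_mem_residuallyUnipotent (hloc n) hN)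
  -- the representations modulo powers of the maximal ideal are compatible
  have hcompat {m n : ℕ} (hmn : m ≤ n) (g : G) (i j : Fin 2) (x : R) (hx : π n x = r n g i j) :
      π m x = r m g i j := by
    let q : R ⧸ maximalIdeal R ^ (n + 1) →+* R ⧸ maximalIdeal R ^ (m + 1) :=
      Ideal.Quotient.factor (Ideal.pow_le_pow_right (Nat.succ_le_succ hmn))
    have hq (y : R) : q (π n y) = π m y := rfl
    have hqs : Function.Surjective q := fun y => by
      obtain ⟨y, rfl⟩ := hπ m y
      exact ⟨π n y, hq y⟩
    have hqπ (M : GL (Fin 2) R) : Matrix.GeneralLinearGroup.map q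
        (Matrix.GeneralLinearGroup.map (π n) M) = Matrix.GeneralLinearGroup.map (π m) M := rfl
    have e : (Matrix.GeneralLinearGroup.map q).comp (r n) = r m :=
      h.monoidHom_ext _ (hP m)
        (Subgroup.isOpen_mono (fun g hg => by
          rw [MonoidHom.mem_ker, MonoidHom.comp_apply, MonoidHom.mem_ker.1 hg, map_one])
          (hr_open n))
        (hr_open m)
        (fun g => map_mem_residuallyUnipotent
          (fun x hx => IsLocalRing.mem_maximalIdeal_of_surjective hqs hx) (hr_mem n g))
        (hr_mem m)
        (by rw [MonoidHom.comp_apply, hrγ, hrγ, hqπ]) (by rw [MonoidHom.comp_apply, hrδ, hrδ, hqπ])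
    rw [← hq, hx, ← e]
    rfl
  -- the limit of the matrices of these representations
  have hlim (g : G) (i j : Fin 2) : ∃ x : R, ∀ n, π n x = r n g i j := by
    choose s hs using fun n => hπ n (r n g i j)
    obtain ⟨x, hx⟩ := IsPrecomplete.prec (I := maximalIdeal R) (M := R) inferInstance
      (f := s) (fun {m n} hmn => by
        rw [SModEq.sub_mem, smul_eq_mul, Ideal.mul_top]
        refine Ideal.pow_le_pow_right m.le_succ (Ideal.Quotient.eq.1 ?_)
        exact (hs m).trans (hcompat hmn g i j _ (hs n)).symm)
    refine ⟨x, fun n => ?_⟩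
    have h1 := hx (n + 1)
    rw [SModEq.sub_mem, smul_eq_mul, Ideal.mul_top] at h1
    exact (Ideal.Quotient.eq.2 h1).symm.trans (hcompat n.le_succ g i j _ (hs (n + 1)))
  choose F hF using hlim
  have hFm (g : G) (n : ℕ) : (Matrix.of (F g)).map (π n) = (r n g).val := by
    ext i j
    exact hF g i j n
  have hext {X Y : Matrix (Fin 2) (Fin 2) R} (hXY : ∀ n, X.map (π n) = Y.map (π n)) : X = Y := by
    ext i j
    exact IsLocalRing.eq_of_forall_mk_eq fun n => congrFun (congrFun (hXY n) i) j
  let ρ₀ : G →* Matrix (Fin 2) (Fin 2) R :=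
    { toFun := fun g => Matrix.of (F g)
      map_one' := hext fun n => by
        rw [hFm, map_one, Matrix.map_one _ (map_zero _) (map_one _), Units.val_one]
      map_mul' := fun g g' => hext fun n => by
        rw [Matrix.map_mul, hFm, hFm, hFm, map_mul, Units.val_mul] }
  let ρ : G →* GL (Fin 2) R := ρ₀.toHomUnits
  have hρ (n : ℕ) : (Matrix.GeneralLinearGroup.map (π n)).comp ρ = r n := by
    ext g i j
    exact hF g i j n
  refine ⟨ρ, isAdicContinuousRep_of_isOpen_ker fun n => ?_, fun g => ?_, ?_, ?_⟩
  · change IsOpen (((Matrix.GeneralLinearGroup.map (π n)).comp ρ).ker : Set G)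
    rw [hρ]
    exact hr_open n
  · have hlift {x : R} (hx : π 0 x ∈ maximalIdeal _) : x ∈ maximalIdeal R := by
      rw [mem_maximalIdeal, mem_nonunits_iff] at hx ⊢
      exact fun hu => hx (hu.map _)
    have := hr_mem 0 g
    rw [← hρ, mem_residuallyUnipotent_iff_mem] at this
    simp only [MonoidHom.comp_apply, Matrix.GeneralLinearGroup.map_apply] at this
    rw [← map_one (π 0), ← map_sub, ← map_sub] at this
    exact mem_residuallyUnipotent_iff_mem.2 ⟨hlift this.1, hlift this.2.1, hlift this.2.2⟩
  · refine Units.ext (hext fun n => ?_)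
    exact (hFm γ n).trans (congrArg Units.val (hrγ n))
  · refine Units.ext (hext fun n => ?_)
    exact (hFm δ n).trans (congrArg Units.val (hrδ n))

end IsFreeProPBasis

end Reps

/-! ### Functoriality of representations and characters -/

section Functoriality

variable {G : Type v} [Group G] [TopologicalSpace G] [IsTopologicalGroup G]
  {R : Type u} [CommRing R] [IsLocalRing R]

theorem IsAdicContinuousRep.map {S : Type*} [CommRing S] [IsLocalRing S] {ρ : G →* GL (Fin 2) R}
    (hρ : IsAdicContinuousRep ρ) {f : R →+* S} (hf : ∀ x ∈ maximalIdeal R, f x ∈ maximalIdeal S) :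
    IsAdicContinuousRep ((Matrix.GeneralLinearGroup.map f).comp ρ) := by
  refine isAdicContinuousRep_of_isOpen_ker fun n => Subgroup.isOpen_mono ?_ (hρ.isOpen_ker (n + 1))
  have hle : maximalIdeal R ^ (n + 1) ≤ (maximalIdeal S ^ (n + 1)).comap f := by
    refine (Ideal.pow_right_mono (show maximalIdeal R ≤ (maximalIdeal S).comap f from hf) _).trans
      (Ideal.le_comap_pow f _)
  intro g hg
  have e : (Matrix.GeneralLinearGroup.map (n := Fin 2)
      (Ideal.Quotient.mk (maximalIdeal S ^ (n + 1)))).comp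
      ((Matrix.GeneralLinearGroup.map f).comp ρ) =
      (Matrix.GeneralLinearGroup.map (Ideal.quotientMap _ f hle)).comp
        ((Matrix.GeneralLinearGroup.map (Ideal.Quotient.mk (maximalIdeal R ^ (n + 1)))).comp ρ) :=
    rfl
  rw [MonoidHom.mem_ker, e, MonoidHom.comp_apply, MonoidHom.mem_ker.1 hg, map_one]

theorem IsAdicContinuousRep.det {ρ : G →* GL (Fin 2) R} (hρ : IsAdicContinuousRep ρ) :
    IsAdicContinuousChar (Matrix.GeneralLinearGroup.det.comp ρ) := by
  refine isAdicContinuousChar_iff_isOpen_ker.2 fun n => Subgroup.isOpen_mono ?_ (hρ.isOpen_ker n)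
  intro g hg
  rw [MonoidHom.mem_ker, MonoidHom.comp_apply] at hg ⊢
  rw [MonoidHom.comp_apply, ← Matrix.GeneralLinearGroup.map_det, hg, map_one]

theorem IsAdicContinuousChar.map {S : Type*} [CommRing S] [IsLocalRing S] {χ : G →* Rˣ}
    (hχ : IsAdicContinuousChar χ) {f : R →+* S}
    (hf : ∀ x ∈ maximalIdeal R, f x ∈ maximalIdeal S) :
    IsAdicContinuousChar ((Units.map (f : R →* S)).comp χ) := by
  refine isAdicContinuousChar_iff_isOpen_ker.2 fun n => Subgroup.isOpen_mono ?_ (hχ.isOpen_ker n)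
  have hle : maximalIdeal R ^ n ≤ (maximalIdeal S ^ n).comap f := by
    refine (Ideal.pow_right_mono (show maximalIdeal R ≤ (maximalIdeal S).comap f from hf) _).trans
      (Ideal.le_comap_pow f _)
  intro g hg
  have hg' : (χ g : R) - 1 ∈ maximalIdeal R ^ n := by
    simpa [MonoidHom.mem_ker, ← Ideal.Quotient.eq, Units.ext_iff] using hg
  have := hle hg'
  rw [Ideal.mem_comap, map_sub, map_one] at this
  simpa [MonoidHom.mem_ker, ← Ideal.Quotient.eq, Units.ext_iff] using this

theorem det_sub_one_mem_of_mem_residuallyUnipotent {M : GL (Fin 2) R}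
    (hM : M ∈ residuallyUnipotent R) : M.val.det - 1 ∈ maximalIdeal R := by
  rw [mem_residuallyUnipotent_iff] at hM
  rw [← residue_eq_zero_iff, Matrix.det_fin_two]
  simp [hM]

end Functoriality

/-! ### Local algebras with the same residue field -/

namespace IsLocalAlgebraWithSameResidueField

variable {O : Type u} [CommRing O] [IsLocalRing O] {A : Type u} [CommRing A] [IsLocalRing A]
  [Algebra O A]

theorem algebraMap_mem (hA : IsLocalAlgebraWithSameResidueField O A) {x : O}
    (hx : x ∈ maximalIdeal O) : algebraMap O A x ∈ maximalIdeal A := by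
  have := hA.isLocalHom
  have hle : (maximalIdeal O).map (algebraMap O A) ≤ maximalIdeal A :=
    ((IsLocalRing.local_hom_TFAE (algebraMap O A)).out 0 2).1 this
  exact hle (Ideal.mem_map_of_mem _ hx)

theorem exists_residue_eq (hA : IsLocalAlgebraWithSameResidueField O A) (y : ResidueField A) :
    ∃ c : O, residue A (algebraMap O A c) = y := by
  have := hA.isLocalHom
  obtain ⟨x, rfl⟩ := hA.bijective.2 y
  obtain ⟨c, rfl⟩ := residue_surjective x
  exact ⟨c, rfl⟩

theorem finite_residueField [Finite (ResidueField O)]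
    (hA : IsLocalAlgebraWithSameResidueField O A) : Finite (ResidueField A) := by
  have := hA.isLocalHom
  exact Finite.of_surjective _ hA.bijective.2

/-- Homomorphisms of `𝒪`-algebras to `A` are local: the composite with the residue map of `A` is
surjective, so its kernel is the maximal ideal. -/
theorem map_mem_maximalIdeal {R : Type*} [CommRing R] [IsLocalRing R] [Algebra O R]
    (hA : IsLocalAlgebraWithSameResidueField O A) (f : R →ₐ[O] A) {x : R}
    (hx : x ∈ maximalIdeal R) : f x ∈ maximalIdeal A := by
  have hs : Function.Surjective ((residue A).comp (f : R →+* A)) := fun y => by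
    obtain ⟨c, rfl⟩ := hA.exists_residue_eq y
    exact ⟨algebraMap O R c, by simp⟩
  have hmax := RingHom.ker_isMaximal_of_surjective _ hs
  rw [← IsLocalRing.eq_maximalIdeal hmax, RingHom.mem_ker] at hx
  exact (residue_eq_zero_iff _).1 hx

end IsLocalAlgebraWithSameResidueField

/-! ### Homomorphisms from the explicit ring and pairs of matrices -/

namespace FramedDetRing

open FramedRing MvPowerSeries

section ResidueField

variable {O : Type u} [CommRing O] [IsLocalRing O] {a b c d : O}

theorem isLocalAlgebraWithSameResidueField [IsLocalRing (FramedDetRing a b c d)] :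
    IsLocalAlgebraWithSameResidueField O (FramedDetRing a b c d) := by
  have hC (s : O) : algebraMap O (FramedDetRing a b c d) s = FramedDetRing.mk a b c d (C s) := rfl
  have hloc : IsLocalHom (algebraMap O (FramedDetRing a b c d)) := by
    refine ((IsLocalRing.local_hom_TFAE _).out 0 2).2 ?_
    rw [Ideal.map_le_iff_le_comap]
    intro x hx
    rw [Ideal.mem_comap, hC]
    exact IsLocalRing.mem_maximalIdeal_of_surjective Ideal.Quotient.mk_surjective
      (C_mem_maximalIdeal_iff.2 hx)
  refine ⟨hloc, RingHom.injective _, fun y => ?_⟩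
  obtain ⟨y, rfl⟩ := residue_surjective y
  obtain ⟨f, rfl⟩ := Ideal.Quotient.mk_surjective y
  refine ⟨residue O (constantCoeff f), ?_⟩
  rw [ResidueField.map_residue, hC, ← sub_eq_zero, ← map_sub, ← map_sub, residue_eq_zero_iff]
  exact mk_mem_maximalIdeal (by simp)

end ResidueField

/-- If `2` is invertible, a matrix determines its coordinates, and these can be arbitrary. The
off-diagonal coordinates are `w` and `y`, the latter shifted by `α`. -/
theorem coordinates_iff {A : Type*} [CommRing A] (h2 : IsUnit (2 : A)) {x y w t α : A}
    {M : Matrix (Fin 2) (Fin 2) A} :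
    !![1 + t + x, y + α; w, 1 + t - x] = M ↔
      x = Ring.inverse 2 * (M 0 0 - M 1 1) ∧ y = M 0 1 - α ∧ w = M 1 0 ∧
        t = Ring.inverse 2 * (M 0 0 + M 1 1) - 1 := by
  have h : (2 : A) * Ring.inverse 2 = 1 := Ring.mul_inverse_cancel _ h2
  constructor
  · rintro rfl
    simp only [Matrix.of_apply, Matrix.cons_val', Matrix.cons_val_zero, Matrix.cons_val_one,
      Matrix.cons_val_fin_one]
    refine ⟨?_, ?_, trivial, ?_⟩
    · linear_combination (-x) * h
    · ring
    · linear_combination (-1 - t) * h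
  · rintro ⟨rfl, rfl, rfl, rfl⟩
    ext i j
    fin_cases i <;> fin_cases j <;> simp
    · linear_combination M 0 0 * h
    · linear_combination M 1 1 * h

section Universal

variable {O : Type u} [CommRing O] {a b : O}

/-- Homomorphisms out of the power series ring correspond to pairs of matrices. -/
theorem map_matγ_matδ_iff {A : Type*} [CommRing A] [Algebra O A] (h2 : IsUnit (2 : O))
    (F : PS O →ₐ[O] A) {M N : Matrix (Fin 2) (Fin 2) A} :
    ((matγ a).map F = M ∧ (matδ b).map F = N) ↔
      ∀ i, F (X i) = ![Ring.inverse 2 * (M 0 0 - M 1 1), M 0 1 - algebraMap O A a, M 1 0,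
        Ring.inverse 2 * (M 0 0 + M 1 1) - 1,
        Ring.inverse 2 * (N 0 0 - N 1 1), N 0 1 - algebraMap O A b, N 1 0,
        Ring.inverse 2 * (N 0 0 + N 1 1) - 1] i := by
  have h2A := isUnit_two_of_algebra A h2
  have hC (s : O) : F (C s) = algebraMap O A s := F.commutes s
  have e1 : (matγ a).map F = !![1 + F (X 3) + F (X 0), F (X 1) + algebraMap O A a;
      F (X 2), 1 + F (X 3) - F (X 0)] := by
    ext i j
    fin_cases i <;> fin_cases j <;> simp [matγ, tγ, x₁₁, x₁₂, x₂₁, hC]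
  have e2 : (matδ b).map F = !![1 + F (X 7) + F (X 4), F (X 5) + algebraMap O A b;
      F (X 6), 1 + F (X 7) - F (X 4)] := by
    ext i j
    fin_cases i <;> fin_cases j <;> simp [matδ, tδ, y₁₁, y₁₂, y₂₁, hC]
  rw [e1, e2, coordinates_iff h2A, coordinates_iff h2A]
  simp only [Fin.forall_fin_succ, Matrix.cons_val_zero, Matrix.cons_val_succ, Fin.forall_fin_zero,
    and_true, Fin.succ_zero_eq_one]
  simp only [and_assoc]
  rfl

theorem det_matγ : (matγ a).det = (1 + tγ) ^ 2 - x₁₁ ^ 2 - x₁₂ a * x₂₁ := by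
  rw [matγ, Matrix.det_fin_two_of]
  ring

theorem det_matδ : (matδ b).det = (1 + tδ) ^ 2 - y₁₁ ^ 2 - y₁₂ b * y₂₁ := by
  rw [matδ, Matrix.det_fin_two_of]
  ring

end Universal

end FramedDetRing

/-! ### The universal framed deformation -/

namespace FramedDetRing

open FramedRing

variable {O : Type u} [CommRing O] {a b c d : O}

theorem det_map_matγ :
    ((matγ a).map (FramedDetRing.mk a b c d)).det =
      algebraMap O (FramedDetRing a b c d) c := by
  rw [← RingHom.mapMatrix_apply, ← RingHom.map_det, det_matγ, mk_det_γ]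
  rfl

theorem det_map_matδ :
    ((matδ b).map (FramedDetRing.mk a b c d)).det =
      algebraMap O (FramedDetRing a b c d) d := by
  rw [← RingHom.mapMatrix_apply, ← RingHom.map_det, det_matδ, mk_det_δ]
  rfl

end FramedDetRing

section Deformation

variable {G : Type v} [Group G] [TopologicalSpace G]
  {O : Type u} [CommRing O] [IsLocalRing O]
  {ρ : G →* GL (Fin 2) (ResidueField O)} {φ : G → ResidueField O} {d : G →* Oˣ} {a b : O}

theorem IsFramedDeformation.mem_residuallyUnipotent
    (hρ : ∀ g, (ρ g : Matrix (Fin 2) (Fin 2) (ResidueField O)) = !![1, φ g; 0, 1])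
    {A : Type u} [CommRing A] [IsLocalRing A] [Algebra O A] {ρA : G →* GL (Fin 2) A}
    (hρA : IsFramedDeformation ρ d ρA) (g : G) : ρA g ∈ residuallyUnipotent A := by
  have h00 := hρA.reduction g 0 0 1 (by simp [hρ])
  have h10 := hρA.reduction g 1 0 0 (by simp [hρ])
  have h11 := hρA.reduction g 1 1 1 (by simp [hρ])
  rw [map_one, map_one] at h00 h11
  rw [map_zero, map_zero] at h10
  exact mem_residuallyUnipotent_iff.2 ⟨h00, h10, h11⟩

variable [IsTopologicalGroup G] [Finite (ResidueField O)] {p : ℕ} [Fact p.Prime] {γ δ : G}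

open FramedRing in
/-- The universal property: the homomorphism sends the variables to the coordinates of `ρA γ` and
`ρA δ`. It kills the relations because the determinant of `ρA` is prescribed. -/
theorem IsFreeProPBasis.existsUnique_algHom (h : IsFreeProPBasis p γ δ)
    (hpO : (p : O) ∈ maximalIdeal O) (h2 : IsUnit (2 : O))
    (hρ : ∀ g, (ρ g : Matrix (Fin 2) (Fin 2) (ResidueField O)) = !![1, φ g; 0, 1])
    (ha : residue O a = φ γ) (hb : residue O b = φ δ)
    [IsLocalRing (FramedDetRing a b (d γ : O) (d δ))]
    {ρu : G →* GL (Fin 2) (FramedDetRing a b (d γ : O) (d δ))} (hc : IsAdicContinuousRep ρu)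
    (hu : ∀ g, ρu g ∈ residuallyUnipotent _)
    (hγ : (ρu γ).val = (matγ a).map (FramedDetRing.mk a b (d γ).val (d δ).val))
    (hδ : (ρu δ).val = (matδ b).map (FramedDetRing.mk a b (d γ).val (d δ).val))
    {A : Type u} [CommRing A] [IsLocalRing A] [IsArtinianRing A] [Algebra O A]
    (hA : IsLocalAlgebraWithSameResidueField O A) {ρA : G →* GL (Fin 2) A}
    (hρA : IsFramedDeformation ρ d ρA) :
    ∃! f : FramedDetRing a b (d γ : O) (d δ) →ₐ[O] A,
      ∀ g, Matrix.GeneralLinearGroup.map (f : _ →+* A) (ρu g) = ρA g := by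
  set R := FramedDetRing a b (d γ : O) (d δ) with hR
  have hpA : (p : A) ∈ maximalIdeal A := by
    simpa using hA.algebraMap_mem hpO
  have hfin : Finite (ResidueField A) := hA.finite_residueField
  have h2A : (2 : A) * Ring.inverse 2 = 1 :=
    Ring.mul_inverse_cancel _ (isUnit_two_of_algebra A h2)
  set M := (ρA γ).val with hM
  set N := (ρA δ).val with hN
  let v : Fin 8 → A := ![Ring.inverse 2 * (M 0 0 - M 1 1), M 0 1 - algebraMap O A a, M 1 0,
        Ring.inverse 2 * (M 0 0 + M 1 1) - 1,
        Ring.inverse 2 * (N 0 0 - N 1 1), N 0 1 - algebraMap O A b, N 1 0,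
        Ring.inverse 2 * (N 0 0 + N 1 1) - 1]
  have hv (i) : v i ∈ maximalIdeal A := by
    have huM := hρA.mem_residuallyUnipotent hρ γ
    have huN := hρA.mem_residuallyUnipotent hρ δ
    have hMa := hρA.reduction γ 0 1 a (by simp [ha, hρ])
    have hNb := hρA.reduction δ 0 1 b (by simp [hb, hρ])
    have h2k : residue A (Ring.inverse 2) * (1 + 1) = 1 := by
      rw [one_add_one_eq_two, ← map_ofNat (residue A) 2, ← map_mul, mul_comm, h2A, map_one]
    rw [mem_residuallyUnipotent_iff, ← hM] at huM
    rw [mem_residuallyUnipotent_iff, ← hN] at huN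
    rw [← hM] at hMa
    rw [← hN] at hNb
    rw [← residue_eq_zero_iff]
    fin_cases i <;> simp [v, huM, huN, hMa, hNb, h2k]
  obtain ⟨F, hF⟩ := MvPowerSeries.exists_algHom_apply_X (A := O) (maximalIdeal A) v hv
  obtain ⟨hFM, hFN⟩ := (FramedDetRing.map_matγ_matδ_iff h2 F).2 hF
  have hFker : ∀ f ∈ detIdeal a b (d γ : O) (d δ), F f = 0 := by
    have hC (s : O) : F (MvPowerSeries.C s) = algebraMap O A s := F.commutes s
    have hdet (X : Matrix (Fin 2) (Fin 2) (PS O)) : F X.det = (X.map F).det :=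
      AlgHom.map_det F X
    change detIdeal a b (d γ : O) (d δ) ≤ RingHom.ker F
    rw [detIdeal, Ideal.span_le]
    rintro f (rfl | rfl)
    · rw [SetLike.mem_coe, RingHom.mem_ker, map_sub, ← FramedDetRing.det_matγ, hdet, hFM, hC, hM,
        hρA.det_eq, sub_self]
    · rw [SetLike.mem_coe, RingHom.mem_ker, map_sub, ← FramedDetRing.det_matδ, hdet, hFN, hC, hN,
        hρA.det_eq, sub_self]
  let f : R →ₐ[O] A := Ideal.Quotient.liftₐ _ F hFker
  have hloc (f : R →ₐ[O] A) (x : R) (hx : x ∈ maximalIdeal R) :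
      (f : R →+* A) x ∈ maximalIdeal A := hA.map_mem_maximalIdeal f hx
  refine ⟨f, DFunLike.congr_fun (f := (Matrix.GeneralLinearGroup.map (f : R →+* A)).comp ρu) ?_,
    fun f' hf' => ?_⟩
  · refine h.rep_ext hpA (hc.map (hloc f)) hρA.continuous
      (fun g => map_mem_residuallyUnipotent (hloc f) (hu g))
      (fun g => hρA.mem_residuallyUnipotent hρ g) ?_ ?_
    · refine Units.ext (Eq.trans ?_ hFM)
      change (ρu γ).val.map f = _
      rw [hγ, Matrix.map_map]
      rfl
    · refine Units.ext (Eq.trans ?_ hFN)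
      change (ρu δ).val.map f = _
      rw [hδ, Matrix.map_map]
      rfl
  · let F' : PS O →ₐ[O] A := f'.comp (Ideal.Quotient.mkₐ O _)
    have hF' : ∀ i, F' (MvPowerSeries.X i) = v i := by
      refine (FramedDetRing.map_matγ_matδ_iff h2 F').1 ⟨?_, ?_⟩
      · rw [hM, ← hf' γ]
        change _ = (ρu γ).val.map f'
        rw [hγ, Matrix.map_map]
        rfl
      · rw [hN, ← hf' δ]
        change _ = (ρu δ).val.map f'
        rw [hδ, Matrix.map_map]
        rfl
    have e : F' = F := MvPowerSeries.algHom_ext_of_isHausdorff (maximalIdeal A)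
      (fun i => by rw [hF' i]; exact hv i) (fun i => (hF' i).trans (hF i).symm)
    ext x
    obtain ⟨x, rfl⟩ := Ideal.Quotient.mk_surjective x
    exact DFunLike.congr_fun e x

variable [IsNoetherianRing O] [IsAdicComplete (maximalIdeal O) O]

open FramedRing in
/-- A representation over the explicit ring with the tautological values at the basis `γ`, `δ` is a
framed deformation: both the reduction and the determinant are determined by the values at `γ`
and `δ`. -/
theorem IsFreeProPBasis.isFramedDeformation (h : IsFreeProPBasis p γ δ)
    (hpO : (p : O) ∈ maximalIdeal O)
    (hρc : IsAdicContinuousRep ρ)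
    (hρ : ∀ g, (ρ g : Matrix (Fin 2) (Fin 2) (ResidueField O)) = !![1, φ g; 0, 1])
    (hdc : IsAdicContinuousChar d) (hd : ∀ g, residue O (d g) = 1)
    (ha : residue O a = φ γ) (hb : residue O b = φ δ)
    [IsLocalRing (FramedDetRing a b (d γ : O) (d δ))]
    {ρu : G →* GL (Fin 2) (FramedDetRing a b (d γ : O) (d δ))} (hc : IsAdicContinuousRep ρu)
    (hu : ∀ g, ρu g ∈ residuallyUnipotent _)
    (hγ : (ρu γ).val = (matγ a).map (FramedDetRing.mk a b (d γ).val (d δ).val))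
    (hδ : (ρu δ).val = (matδ b).map (FramedDetRing.mk a b (d γ).val (d δ).val)) :
    IsFramedDeformation ρ d ρu := by
  set R := FramedDetRing a b (d γ : O) (d δ) with hR
  have hRO : IsLocalAlgebraWithSameResidueField O R :=
    FramedDetRing.isLocalAlgebraWithSameResidueField
  have : IsAdicComplete (maximalIdeal R) R := FramedDetRing.isAdicComplete
  have hpR : (p : R) ∈ maximalIdeal R := by
    simpa using hRO.algebraMap_mem hpO
  have := hRO.isLocalHom
  have hfin : Finite (ResidueField R) := hRO.finite_residueField
  refine ⟨hc, ?_, ?_⟩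
  · have hfin' : Finite (ResidueField (ResidueField R)) :=
      Finite.of_surjective _ residue_surjective
    let κ : ResidueField O →+* ResidueField R := ResidueField.map (algebraMap O R)
    have hκ (x : ResidueField O) (hx : x ∈ maximalIdeal (ResidueField O)) :
        κ x ∈ maximalIdeal (ResidueField R) := by
      rw [maximalIdeal_eq_bot, Ideal.mem_bot] at hx ⊢
      rw [hx, map_zero]
    have hres (x : R) (hx : x ∈ maximalIdeal R) :
        residue R x ∈ maximalIdeal (ResidueField R) := by
      rw [(residue_eq_zero_iff x).2 hx]
      exact zero_mem _
    have hv (i : Fin 8) : residue R (FramedDetRing.mk a b (d γ).val (d δ).val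
        (MvPowerSeries.X i)) = 0 :=
      (residue_eq_zero_iff _).2 (FramedDetRing.mk_mem_maximalIdeal (by simp))
    have hC (s : O) : residue R (FramedDetRing.mk a b (d γ).val (d δ).val (MvPowerSeries.C s)) =
        κ (residue O s) := rfl
    have hρu (g : G) : ρ g ∈ residuallyUnipotent (ResidueField O) := by
      rw [mem_residuallyUnipotent_iff]
      simp [hρ]
    -- over the residue field of `R`, the reductions of `ρu` and `ρ` agree at `γ` and `δ`
    have e : (Matrix.GeneralLinearGroup.map (residue R)).comp ρu =
        (Matrix.GeneralLinearGroup.map κ).comp ρ := by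
      refine h.rep_ext (by simpa using hres _ hpR) (hc.map hres) (hρc.map hκ)
        (fun g => map_mem_residuallyUnipotent hres (hu g))
        (fun g => map_mem_residuallyUnipotent hκ (hρu g)) ?_ ?_
      · ext i j
        simp only [MonoidHom.comp_apply, Matrix.GeneralLinearGroup.map_apply, hρ, hγ]
        fin_cases i <;> fin_cases j <;>
          simp [matγ, tγ, x₁₁, x₁₂, x₂₁, hv, hC, ha]
      · ext i j
        simp only [MonoidHom.comp_apply, Matrix.GeneralLinearGroup.map_apply, hρ, hδ]
        fin_cases i <;> fin_cases j <;>
          simp [matδ, tδ, y₁₁, y₁₂, y₂₁, hv, hC, hb]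
    intro g i j c hcg
    have := congrArg (fun M : GL (Fin 2) (ResidueField R) => M i j) (DFunLike.congr_fun e g)
    simp only [MonoidHom.comp_apply, Matrix.GeneralLinearGroup.map_apply] at this
    rw [this, ← hcg]
    rfl
  · have e : Matrix.GeneralLinearGroup.det.comp ρu =
        (Units.map (algebraMap O R : O →* R)).comp d := by
      refine h.char_ext hpR hc.det (hdc.map fun x hx => hRO.algebraMap_mem hx)
        (fun g => det_sub_one_mem_of_mem_residuallyUnipotent (hu g)) (fun g => ?_) ?_ ?_
      · have := hd g
        rw [← map_one (residue O), ← sub_eq_zero, ← map_sub, residue_eq_zero_iff] at this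
        simpa using hRO.algebraMap_mem this
      · refine Units.ext ?_
        change (ρu γ).val.det = _
        rw [hγ, FramedDetRing.det_map_matγ]
        rfl
      · refine Units.ext ?_
        change (ρu δ).val.det = _
        rw [hδ, FramedDetRing.det_map_matδ]
        rfl
    intro g
    exact congrArg Units.val (DFunLike.congr_fun e g)

open FramedRing in
theorem IsFreeProPBasis.exists_isUniversalFramedDeformation (h : IsFreeProPBasis p γ δ)
    (hpO : (p : O) ∈ maximalIdeal O) (h2 : IsUnit (2 : O))
    (hρc : IsAdicContinuousRep ρ)
    (hρ : ∀ g, (ρ g : Matrix (Fin 2) (Fin 2) (ResidueField O)) = !![1, φ g; 0, 1])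
    (hdc : IsAdicContinuousChar d) (hd : ∀ g, residue O (d g) = 1)
    (ha : residue O a = φ γ) (hb : residue O b = φ δ)
    [IsLocalRing (FramedDetRing a b (d γ : O) (d δ))] :
    ∃ ρu : G →* GL (Fin 2) (FramedDetRing a b (d γ : O) (d δ)),
      IsUniversalFramedDeformation ρ d ρu ∧
      (ρu γ).val = (matγ a).map (FramedDetRing.mk a b (d γ).val (d δ).val) ∧
      (ρu δ).val = (matδ b).map (FramedDetRing.mk a b (d γ).val (d δ).val) := by
  set R := FramedDetRing a b (d γ : O) (d δ) with hR
  have hRO : IsLocalAlgebraWithSameResidueField O R :=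
    FramedDetRing.isLocalAlgebraWithSameResidueField
  have : IsAdicComplete (maximalIdeal R) R := FramedDetRing.isAdicComplete
  have hpR : (p : R) ∈ maximalIdeal R := by
    simpa using hRO.algebraMap_mem hpO
  have hfin : Finite (ResidueField R) := hRO.finite_residueField
  let M : GL (Fin 2) R := Matrix.GeneralLinearGroup.mk''
    ((matγ a).map (FramedDetRing.mk a b (d γ).val (d δ).val))
    (FramedDetRing.det_map_matγ (a := a) ▸ (d γ).isUnit.map _)
  let N : GL (Fin 2) R := Matrix.GeneralLinearGroup.mk''
    ((matδ b).map (FramedDetRing.mk a b (d γ).val (d δ).val))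
    (FramedDetRing.det_map_matδ (b := b) ▸ (d δ).isUnit.map _)
  have hv (i : Fin 8) : residue R (FramedDetRing.mk a b (d γ).val (d δ).val
      (MvPowerSeries.X i)) = 0 :=
    (residue_eq_zero_iff _).2 (FramedDetRing.mk_mem_maximalIdeal (by simp))
  have hMu : M ∈ residuallyUnipotent R := by
    rw [mem_residuallyUnipotent_iff]
    simp [M, matγ, tγ, x₁₁, x₁₂, x₂₁, hv]
  have hNu : N ∈ residuallyUnipotent R := by
    rw [mem_residuallyUnipotent_iff]
    simp [N, matδ, tδ, y₁₁, y₁₂, y₂₁, hv]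
  obtain ⟨ρu, hc, hu, hγ, hδ⟩ := h.exists_rep hpR hMu hNu
  replace hγ := congrArg Units.val hγ
  replace hδ := congrArg Units.val hδ
  exact ⟨ρu, ⟨inferInstance, inferInstance, hRO,
    h.isFramedDeformation hpO hρc hρ hdc hd ha hb hc hu hγ hδ,
    fun A _ _ _ _ hA ρA hρA =>
      h.existsUnique_algHom hpO h2 hρ ha hb hc hu hγ hδ hA hρA⟩, hγ, hδ⟩

end Deformation

namespace FramedDetRing

open FramedRing

theorem trace_eq_of_isTraceMap {O : Type u} [CommRing O] {a b c d : O} (h2 : IsUnit (2 : O))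
    {Φ : MvPowerSeries (Fin 3) O →ₐ[O] FramedDetRing a b c d} (hΦ : IsTraceMap a b c d Φ)
    {M N : Matrix (Fin 2) (Fin 2) (FramedDetRing a b c d)}
    (hM : M = (matγ a).map (FramedDetRing.mk a b c d))
    (hN : N = (matδ b).map (FramedDetRing.mk a b c d)) :
    M.trace = Φ (2 * (1 + MvPowerSeries.X 0)) ∧ N.trace = Φ (2 * (1 + MvPowerSeries.X 1)) ∧
      (M * N).trace = Φ (2 * (1 + MvPowerSeries.X 2)) := by
  obtain ⟨h0, h1, h3⟩ := hΦ
  have h := congrArg (FramedDetRing.mk a b c d)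
    (Ring.mul_inverse_cancel _ (isUnit_two_of_algebra (PS O) h2))
  rw [map_mul, map_ofNat, map_one] at h
  subst hM hN
  simp only [map_mul, map_add, map_one, map_ofNat, h0, h1, h3, map_sub]
  simp only [Matrix.trace_fin_two, Matrix.mul_apply, Fin.sum_univ_two, matγ, matδ, Matrix.map_apply,
    Matrix.of_apply, Matrix.cons_val', Matrix.cons_val_zero, Matrix.cons_val_one,
    Matrix.cons_val_fin_one, FramedRing.z, map_add, map_sub, map_mul, map_one, map_ofNat]
  refine ⟨by ring, by ring, ?_⟩
  set r := FramedDetRing.mk a b c d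
  linear_combination (-(r (x₁₂ a) * r y₂₁ + 2 * r x₁₁ * r y₁₁ + r x₂₁ * r (y₁₂ b))) * h

end FramedDetRing

/-! ### Finite extensions of complete local rings -/

/-- A finite module over a complete ring is complete. -/
theorem IsPrecomplete.of_finite {A : Type*} [CommRing A] (I : Ideal A) [IsPrecomplete I A]
    (M : Type*) [AddCommGroup M] [Module A M] [Module.Finite A M] : IsPrecomplete I M := by
  rw [← AdicCompletion.of_surjective_iff]
  intro y
  obtain ⟨t, rfl⟩ := AdicCompletion.ofTensorProduct_surjective_of_finite I M y
  induction t with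
  | zero => exact ⟨0, by simp⟩
  | tmul r x =>
    obtain ⟨s, rfl⟩ := AdicCompletion.of_surjective I A r
    refine ⟨s • x, ?_⟩
    ext n
    rw [AdicCompletion.ofTensorProduct_tmul, AdicCompletion.smul_eval, AdicCompletion.of_apply,
      AdicCompletion.of_apply]
    rfl
  | add t t' ht ht' =>
    obtain ⟨x, hx⟩ := ht
    obtain ⟨x', hx'⟩ := ht'
    exact ⟨x + x', by rw [map_add, map_add, hx, hx']⟩

/-- Completeness depends only on the topology defined by the ideal. -/
theorem IsPrecomplete.of_pow_le {B : Type*} [CommRing B] {I J : Ideal B} [IsPrecomplete J B]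
    {N : ℕ} (hN : I ^ N ≤ J) (hJ : J ≤ I) : IsPrecomplete I B := by
  refine ⟨fun f hf => ?_⟩
  have hle (n : ℕ) : n ≤ (N + 1) * n := Nat.le_mul_of_pos_left n N.succ_pos
  simp only [smul_eq_mul, Ideal.mul_top, SModEq.sub_mem] at hf ⊢
  -- the subsequence of the terms `f ((N + 1) * n)` is Cauchy for `J`; the summand `1` makes it
  -- cofinal also when `N = 0`
  obtain ⟨x, hx⟩ := IsPrecomplete.prec (I := J) (M := B) inferInstance
    (f := fun n => f ((N + 1) * n)) (fun {m n} hmn => by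
      rw [SModEq.sub_mem, smul_eq_mul, Ideal.mul_top]
      have h : I ^ ((N + 1) * m) ≤ J ^ m := by
        rw [pow_mul]
        exact Ideal.pow_right_mono ((Ideal.pow_le_pow_right N.le_succ).trans hN) m
      exact h (hf (Nat.mul_le_mul_left _ hmn)))
  refine ⟨x, fun n => ?_⟩
  have := hx n
  rw [SModEq.sub_mem, smul_eq_mul, Ideal.mul_top] at this
  have := add_mem (hf (hle n)) (Ideal.pow_right_mono hJ n this)
  rwa [sub_add_sub_cancel] at this

/-- A finite local extension of a complete local noetherian ring is complete. -/
theorem IsAdicComplete.of_finite_of_isLocalHom (A : Type*) [CommRing A] [IsLocalRing A]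
    [IsNoetherianRing A] [IsAdicComplete (maximalIdeal A) A] (B : Type*) [CommRing B]
    [IsLocalRing B] [Algebra A B] [Module.Finite A B] [IsLocalHom (algebraMap A B)] :
    IsAdicComplete (maximalIdeal B) B := by
  have : IsNoetherianRing B := IsNoetherianRing.of_finite A B
  have hle : (maximalIdeal A).map (algebraMap A B) ≤ maximalIdeal B :=
    ((IsLocalRing.local_hom_TFAE (algebraMap A B)).out 0 2).1 ‹_›
  have h1 : IsPrecomplete (maximalIdeal A) B := IsPrecomplete.of_finite _ B
  have h2 : IsPrecomplete ((maximalIdeal A).map (algebraMap A B)) B :=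
    IsPrecomplete.map_algebraMap_iff.2 h1
  have h3 : Module.Finite (A ⧸ maximalIdeal A) (B ⧸ (maximalIdeal A).map (algebraMap A B)) :=
    Module.Finite.of_restrictScalars_finite A _ _
  have h4 : IsArtinianRing (A ⧸ maximalIdeal A) :=
    inferInstanceAs (IsArtinianRing (ResidueField A))
  have h5 : IsArtinianRing (B ⧸ (maximalIdeal A).map (algebraMap A B)) :=
    IsArtinianRing.of_finite (A ⧸ maximalIdeal A) _
  obtain ⟨N, hN⟩ := IsLocalRing.exists_maximalIdeal_pow_le_of_isArtinianRing_quotient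
    ((maximalIdeal A).map (algebraMap A B))
  have := IsPrecomplete.of_pow_le hN hle
  exact { toIsPrecomplete := this, toIsHausdorff := inferInstance }

theorem PadicInt.isUnit_two {p : ℕ} [Fact p.Prime] (hp : 2 < p) : IsUnit (2 : ℤ_[p]) := by
  rw [PadicInt.isUnit_iff]
  have h : ¬ p ∣ 2 := fun h => (Nat.le_of_dvd two_pos h).not_gt hp
  by_contra hne
  have := (PadicInt.norm_le_one (2 : ℤ_[p])).lt_of_ne hne
  have h2 : ‖((2 : ℤ) : ℤ_[p])‖ < 1 := by simpa using this
  rw [PadicInt.norm_int_lt_one_iff_dvd] at h2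
  exact h (by exact_mod_cast h2)

/-! ### The ring of integers and the cyclotomic character -/

section RingOfIntegers

variable (p : ℕ) [Fact p.Prime] (L : Type u) [Field L] [Algebra ℚ_[p] L]
  [FiniteDimensional ℚ_[p] L] [Algebra ℤ_[p] L] [IsScalarTower ℤ_[p] ℚ_[p] L]

theorem PadicRingOfIntegers.natCast_mem_maximalIdeal :
    (p : PadicRingOfIntegers p L) ∈ maximalIdeal (PadicRingOfIntegers p L) := by
  rw [mem_maximalIdeal, mem_nonunits_iff, norm_one_of_isUnit_padicRingOfIntegers]
  have e : ((p : PadicRingOfIntegers p L) : L) = algebraMap ℚ_[p] L p := by simp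
  rw [e, spectralNorm_extends]
  exact Padic.norm_p_lt_one.ne

instance PadicRingOfIntegers.isLocalHom :
    IsLocalHom (algebraMap ℤ_[p] (PadicRingOfIntegers p L)) := by
  refine ((IsLocalRing.local_hom_TFAE _).out 0 2).2 ?_
  rw [PadicInt.maximalIdeal_eq_span_p, Ideal.map_span, Set.image_singleton,
    Ideal.span_singleton_le_iff_mem, map_natCast]
  exact natCast_mem_maximalIdeal p L

instance PadicRingOfIntegers.module_finite : Module.Finite ℤ_[p] (PadicRingOfIntegers p L) :=
  IsIntegralClosure.finite ℤ_[p] ℚ_[p] L _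

theorem PadicRingOfIntegers.isNoetherianRing : IsNoetherianRing (PadicRingOfIntegers p L) :=
  IsNoetherianRing.of_finite ℤ_[p] _

theorem PadicRingOfIntegers.isAdicComplete :
    IsAdicComplete (maximalIdeal (PadicRingOfIntegers p L)) (PadicRingOfIntegers p L) :=
  have := isNoetherianRing p L
  IsAdicComplete.of_finite_of_isLocalHom ℤ_[p] _

theorem PadicRingOfIntegers.finite_residueField :
    Finite (ResidueField (PadicRingOfIntegers p L)) :=
  ResidueField.finite_of_finite (R := ℤ_[p])
    (Finite.of_equiv (ZMod p) PadicInt.residueField.symm.toEquiv)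

theorem isAdicContinuousChar_cycloChar :
    IsAdicContinuousChar (cycloChar p (PadicRingOfIntegers p L)) := by
  have hloc (x : ℤ_[p]) (hx : x ∈ maximalIdeal ℤ_[p]) :
      algebraMap ℤ_[p] (PadicRingOfIntegers p L) x ∈ maximalIdeal _ := by
    rw [mem_maximalIdeal, mem_nonunits_iff] at hx ⊢
    exact fun hu => hx (isUnit_of_map_unit _ _ hu)
  let χ : GalQp p →* ℤ_[p]ˣ := (cyclotomicCharacter (AlgebraicClosure ℚ_[p]) p).comp
      (MulSemiringAction.toRingAut (AlgebraicClosure ℚ_[p] ≃ₐ[ℚ_[p]] AlgebraicClosure ℚ_[p])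
        (AlgebraicClosure ℚ_[p]))
  have hχ : Continuous χ := cyclotomicCharacter.continuous p ℚ_[p] (AlgebraicClosure ℚ_[p])
  have h : IsAdicContinuousChar χ := by
    intro n
    have : {g : GalQp p | (χ g : ℤ_[p]) - 1 ∈ maximalIdeal ℤ_[p] ^ n} =
        (fun g => ((χ g : ℤ_[p]) - 1)) ⁻¹' Metric.ball 0 ((p : ℝ) ^ (-n + 1 : ℤ)) := by
      ext g
      rw [PadicInt.maximalIdeal_eq_span_p, Ideal.span_singleton_pow]
      simp only [Set.mem_ofPred_eq, Set.mem_preimage, mem_ball_zero_iff]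
      rw [← PadicInt.norm_le_pow_iff_mem_span_pow, PadicInt.norm_le_pow_iff_norm_lt_pow_add_one]
    rw [this]
    exact Metric.isOpen_ball.preimage ((Units.continuous_val.comp hχ).sub continuous_const)
  exact h.map hloc

end RingOfIntegers

theorem IsAdicContinuousChar.mul {G : Type v} [Group G] [TopologicalSpace G] [IsTopologicalGroup G]
    {R : Type u} [CommRing R] [IsLocalRing R] {χ χ' : G →* Rˣ} (hχ : IsAdicContinuousChar χ)
    (hχ' : IsAdicContinuousChar χ') : IsAdicContinuousChar (χ * χ') := by
  refine isAdicContinuousChar_iff_isOpen_ker.2 fun n => ?_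
  refine Subgroup.isOpen_mono (H₁ := _ ⊓ _) ?_ ((hχ.isOpen_ker n).inter (hχ'.isOpen_ker n))
  rintro g ⟨hg, hg'⟩
  replace hg := MonoidHom.mem_ker.1 hg
  replace hg' := MonoidHom.mem_ker.1 hg'
  rw [MonoidHom.comp_apply] at hg hg'
  rw [MonoidHom.mem_ker, MonoidHom.comp_apply, MonoidHom.mul_apply, map_mul, hg, hg', one_mul]

theorem mainTheorem3 (p : ℕ) [Fact p.Prime] (hp : 2 < p)
    -- `L` is a finite extension of `ℚ_p`; `𝒪 = PadicRingOfIntegers p L`, `k` its residue field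
    (L : Type u) [Field L] [Algebra ℚ_[p] L] [FiniteDimensional ℚ_[p] L]
    [Algebra ℤ_[p] L] [IsScalarTower ℤ_[p] ℚ_[p] L]
    (ρ : GalQp p →* GL (Fin 2) (ResidueField (PadicRingOfIntegers p L)))
    (hρ_cont : IsAdicContinuousRep ρ)
    (φ : GalQp p → ResidueField (PadicRingOfIntegers p L))
    (hρ : ∀ g, (ρ g : Matrix (Fin 2) (Fin 2) (ResidueField (PadicRingOfIntegers p L))) =
      !![1, φ g; 0, 1])
    (ψ : GalQp p →* (PadicRingOfIntegers p L)ˣ)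
    (hψ_cont : IsAdicContinuousChar ψ)
    -- `ψε` is the product of `ψ` and the cyclotomic character; it is trivial modulo `ϖ`
    (ψε : GalQp p →* (PadicRingOfIntegers p L)ˣ)
    (hψε : ψε = ψ * cycloChar p (PadicRingOfIntegers p L))
    (hψε_one : ∀ g, residue (PadicRingOfIntegers p L) (ψε g) = 1)
    (γ δ : GalQp p)
    (a b : PadicRingOfIntegers p L)
    (ha : residue (PadicRingOfIntegers p L) a = φ γ)
    (hb : residue (PadicRingOfIntegers p L) b = φ δ) :
    -- if `γ, δ` freely generate the maximal pro-`p` quotient of `G_{ℚ_p}`, then the explicit ring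
    -- is the universal framed deformation ring of `ρ` with determinant `ψε`, and the map `Φ` below
    -- is given by the trace of the universal framed deformation
    (IsFreeProPBasis p γ δ →
      ∃ (_ : IsLocalRing (FramedDetRing a b (ψε γ : PadicRingOfIntegers p L) (ψε δ)))
        (ρu : GalQp p →* GL (Fin 2) (FramedDetRing a b (ψε γ : PadicRingOfIntegers p L) (ψε δ))),
        IsUniversalFramedDeformation ρ ψε ρu ∧
        (ρu γ).val = (FramedRing.matγ a).map (FramedDetRing.mk a b (ψε γ).val (ψε δ).val) ∧
        (ρu δ).val = (FramedRing.matδ b).map (FramedDetRing.mk a b (ψε γ).val (ψε δ).val) ∧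
        ∀ Φ, IsTraceMap a b (ψε γ : PadicRingOfIntegers p L) (ψε δ) Φ →
          (ρu γ).val.trace = Φ (2 * (1 + MvPowerSeries.X 0)) ∧
          (ρu δ).val.trace = Φ (2 * (1 + MvPowerSeries.X 1)) ∧
          (ρu (γ * δ)).val.trace = Φ (2 * (1 + MvPowerSeries.X 2)) ∧
          (ρu (δ * γ)).val.trace = Φ (2 * (1 + MvPowerSeries.X 2))) ∧
    -- the map `Φ : 𝒪⟦t₁, t₂, t₃⟧ → R` exists, is unique, and is flat
    (∃! Φ, IsTraceMap a b (ψε γ : PadicRingOfIntegers p L) (ψε δ) Φ) ∧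
    ∀ Φ, IsTraceMap a b (ψε γ : PadicRingOfIntegers p L) (ψε δ) Φ → Φ.toRingHom.Flat := by
  let O := PadicRingOfIntegers p L
  have : IsNoetherianRing O := PadicRingOfIntegers.isNoetherianRing p L
  have : IsAdicComplete (maximalIdeal O) O := PadicRingOfIntegers.isAdicComplete p L
  have : Finite (ResidueField O) := PadicRingOfIntegers.finite_residueField p L
  have h2 : IsUnit (2 : O) := isUnit_two_of_algebra O (PadicInt.isUnit_two hp)
  have hψε_cont : IsAdicContinuousChar ψε :=
    hψε ▸ hψ_cont.mul (isAdicContinuousChar_cycloChar p L)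
  refine ⟨fun h => ?_, FramedDetRing.existsUnique_isTraceMap (hψε_one γ) (hψε_one δ),
    fun Φ hΦ => FramedDetRing.flat_of_isTraceMap h2 (hψε_one γ) (hψε_one δ) Φ hΦ⟩
  have hR := FramedDetRing.isLocalRing (a := a) (b := b) (hψε_one γ) (hψε_one δ)
  obtain ⟨ρu, hu, hγ, hδ⟩ := h.exists_isUniversalFramedDeformation
    (PadicRingOfIntegers.natCast_mem_maximalIdeal p L) h2 hρ_cont hρ hψε_cont hψε_one ha hb
  refine ⟨hR, ρu, hu, hγ, hδ, fun Φ hΦ => ?_⟩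
  obtain ⟨h0, h1, h3⟩ := FramedDetRing.trace_eq_of_isTraceMap h2 hΦ hγ hδ
  refine ⟨h0, h1, ?_, ?_⟩
  · rw [map_mul, Units.val_mul, h3]
  · rw [map_mul, Units.val_mul, Matrix.trace_mul_comm, h3]
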